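/- Consider the problem of minimizing $f_0(x)$ over $x\in\mathbb R^n$ subject to $f_i(x)\le 0$ ($i=1,\dots,k$), $Ax-b\le 0$, $\|x\|_0\le s$, $x\in X_1\times\dots\times X_n$, where $f_i(x)=\frac12x^\top Q_ix+q_i^\top x+c_i$ with $Q_i$ symmetric ($i=0,\dots,k$), $A\in\mathbb R^{m\times n}$ has rows $a_1^\top,\dots,a_m^\top$, $0\le s\le n$, and each $X_i\ni 0$ is a closed interval in $\mathbb R$ (possibly unbounded). Let $L(x,\mu,\lambda)=f_0(x)+\sum_i\mu_if_i(x)+\langle\lambda,Ax-b\rangle$, $\mathbb S=\{x:\|x\|_0\le s\}$, $\phi(a,b)=\sqrt{a^2+b^2}-a-b$, $Y=(x,\nu,\mu,\lambda)\in\mathbb R^n\times\mathbb R^n\times\mathbb R^k\times\mathbb R^m$ with the Euclidean norm. $\Pi_\Omega$ is the Euclidean projection onto $\Omega$; subscripts denote subvectors and submatrices and $\overline T=[n]\setminus T$. For $\tau>0$ put $u=x-\tau(\nabla_xL(x,\mu,\lambda)+\nu)$, and let $\mathbb T_\tau(Y)$ be the family of all $T\subseteq[n]$ with $|T|=s$ and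 $|u_i|\ge|u_j|$ for all $i\in T$, $j\notin T$. For $T\subseteq[n]$ let $$F(Y;T)=\bigl((\nabla_xL(x,\mu,\lambda)+\nu)_T;\ x_{\overline T};\ x_T-\Pi_{X_T}(x_T+\nu_T);\ \nu_{\overline T};\ (\phi(-f_i(x),\mu_i))_{i\le k};\ (\phi(b_j-\langle a_j,x\rangle,\lambda_j))_{j\le m}\bigr),$$ where $X_T=\prod_{i\in T}X_i$; $\partial F(Y;T)$ is the Clarke generalized Jacobian with respect to $Y$, and $\Psi(Y;T)=\frac12\|F(Y;T)\|^2$. **Algorithm SNSQP.** Parameters: $\tau>0$, $\varepsilon\geq 0$, $\rho\in(0,1)$, $\sigma\in(0,1/2)$, and a non-increasing sequence $\kappa_\ell>0$ with $\kappa_\ell\to0$. Start with $Y^0$ and $T_0\in\mathbb T_\tau(Y^0)$. While $\|F(Y^\ell;T_\ell)\|>\varepsilon$: choose $W^\ell\in\partial F(Y^\ell;T_\ell)$. Let $K$ be the set of coordinates $(x_{T_\ell},\nu_{T_\ell},\mu,\lambda)$, let $G^\ell$ be the block of $W^\ell$ with rows and columns in $K$ (rows being paired with columns so that the first and second rows of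 $F$ correspond to $x_{T_\ell}$ and $x_{\overline T_\ell}$, the third and fourth to $\nu_{T_\ell}$ and $\nu_{\overline T_\ell}$), and let $D^\ell$ be the block with rows in $K$ and columns $x_{\overline T_\ell}$. The direction $d^\ell$ has $x_{\overline T_\ell}$-part $-x^\ell_{\overline T_\ell}$, $\nu_{\overline T_\ell}$-part $-\nu^\ell_{\overline T_\ell}$, and its $K$-part solves $G^\ell d_K=r^\ell$, with $r^\ell:=D^\ell x^\ell_{\overline T_\ell}-F(Y^\ell;T_\ell)_K$, if this system is solvable, and $({G^\ell}^\top G^\ell+\kappa_\ell I)d_K={G^\ell}^\top r^\ell$ otherwise. Write $d^\ell(\alpha)$ for $d^\ell$ with its $K$-part multiplied by $\alpha$. Let $t_\ell$ be the smallest integer $t\ge0$ with $\Psi(Y^\ell+d^\ell(\rho^{t});T_\ell)\le\Psi(Y^\ell;T_\ell)+\sigma\rho^{t}\langle F(Y^\ell;T_\ell),W^\ell d^\ell\rangle$; set $Y^{\ell+1}=Y^\ell+d^\ell(\rho^{t_\ell})$ and choose any $T_{\ell+1}\in\mathbb T_\tau(Y^{\ell+1})$. (With $\varepsilon=0$ the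 algorithm only stops at an exact zero of $F(\cdot;T_\ell)$.) **Assumptions.** Let $\tau>0$ and let $x^*$ be a P-stationary point with multipliers $\nu^*,\mu^*,\lambda^*$, and $Y^*=(x^*,\nu^*,\mu^*,\lambda^*)$; that is, with $\Gamma_*=\operatorname{supp}(x^*)$ and $g^*=\nabla_xL(x^*,\mu^*,\lambda^*)$: $x^*$ is the unique projection of $x^*-\tau(g^*+\nu^*)$ onto $\mathbb S$; $x^*_{i}=\Pi_{X_i}(x^*_i+\nu^*_i)$ for $i\in\Gamma_*$ and $\nu^*_i=0$ for $i\notin\Gamma_*$; $f_i(x^*)\le0$, $\mu^*_i\ge0$, $\mu_i^*f_i(x^*)=0$ for $i\le k$; $Ax^*-b\le0$, $\lambda^*\ge0$, $\langle\lambda^*,Ax^*-b\rangle=0$. Suppose: * (restricted LICQ) $x^*$ is feasible, and for every $T\supseteq\Gamma_*$ with $|T|=s$ the family of the vectors $(\nabla f_i(x^*))_{\Gamma_*}$ ($f_i(x^*)=0$), $(a_j)_{\Gamma_*}$ ($\langle a_j,x^*\rangle=b_j$), $(e_i)_{\Gamma_*}$ ($i\in T$, $x_i^*\in\operatorname{bd}X_i$)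 is linearly independent, where $e_i$ is the $i$-th standard basis vector of $\mathbb R^n$; * (strong second-order condition) for every $T\in\mathbb T_\tau(Y^*)$, $\langle d,\nabla^2_{xx}L(x^*,\mu^*,\lambda^*)d\rangle>0$ for all $0\ne d\in\mathbb R^n$ such that $\langle\nabla f_i(x^*),d\rangle=0$ whenever $\mu_i^*>0$ and $f_i(x^*)=0$; $\langle a_j,d\rangle=0$ whenever $\lambda_j^*>0$ and $\langle a_j,x^*\rangle=b_j$; and $d_i=0$ whenever $i\in T$, $\nu^*_i\neq0$ and $x^*_i\in\operatorname{bd}X_i$. **Theorem (local quadratic convergence of SNSQP).** For every $\sigma\in(0,1/2)$ there are a neighbourhood $U$ of $Y^*$ and a constant $C>0$ such that, for all $\rho\in(0,1)$, all $\varepsilon\ge0$ and all sequences $(\kappa_\ell)$ as above: 1. from every $Y\in U$ and $T\in\mathbb T_\tau(Y)$ an iteration can be carried out: $\partial F(Y;T)\neq\emptyset$, and for every choice of $W\in\partial F(Y;T)$ the direction, the line search step and a next index set exist; 2. for every run of the algorithm with $Y^0\in U$, whatever the choices of $T_\ell\in\mathbb T_\tau(Y^\ell)$ and $W^\ell\in\partial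 F(Y^\ell;T_\ell)$ (so $T_\ell$ may change from step to step), every iteration performed is a full Newton step: $W^\ell$ is nonsingular, $W^\ell d^\ell=-F(Y^\ell;T_\ell)$, $t_\ell=0$ and $Y^{\ell+1}=Y^\ell+d^\ell$; moreover $Y^{\ell+1}\in U$ and $\|Y^{\ell+1}-Y^*\|\le C\|Y^\ell-Y^*\|^2$; 3. if such a run is infinite, then $Y^\ell\to Y^*$; and if $F(Y^\ell;T_\ell)=0$ at some iterate of such a run, then $Y^\ell=Y^*$. -/

import Mathlib

open Filter Topology

noncomputable section

namespace SNSQP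

/-! ### General notions -/

/-- The set of Euclidean projections of `v` onto `Ω`, i.e. `argmin_{z ∈ Ω} ‖z - v‖`. -/
def projSet {E : Type*} [NormedAddCommGroup E] (Ω : Set E) (v : E) : Set E :=
  {z | z ∈ Ω ∧ ∀ w ∈ Ω, ‖z - v‖ ≤ ‖w - v‖}

/-- The projection of a real number onto a set of reals; for a nonempty closed interval it is the
unique nearest point, see `projSet_eq_singleton`. -/
def proj (I : Set ℝ) (v : ℝ) : ℝ := Classical.epsilon fun z => z ∈ projSet I v

/-- On a nonempty closed interval (bounded or not) the projection is well defined. -/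
theorem projSet_eq_singleton {I : Set ℝ} (hc : IsClosed I) (ho : I.OrdConnected)
    (hne : I.Nonempty) (v : ℝ) : projSet I v = {proj I v} := by
  have hex : ∃ z, z ∈ projSet I v := by
    obtain ⟨z, hz, hd⟩ := hc.exists_infDist_eq_dist hne v
    refine ⟨z, hz, fun w hw => ?_⟩
    have h := Metric.infDist_le_dist_of_mem (x := v) hw
    rw [hd, dist_comm, dist_comm v w, dist_eq_norm, dist_eq_norm] at h
    exact h
  have hp : proj I v ∈ projSet I v := Classical.epsilon_spec hex
  have key : ∀ a b : ℝ, a ∈ projSet I v → b ∈ projSet I v → a ≤ b → a = b := by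
    intro a b ha hb hab
    by_contra hne'
    have hlt : a < b := lt_of_le_of_ne hab hne'
    have hm : (a + b) / 2 ∈ I :=
      ho.out ha.1 hb.1 ⟨by linarith, by linarith⟩
    have h1 := ha.2 _ hm
    have h2 := hb.2 _ hm
    simp only [Real.norm_eq_abs] at h1 h2
    rcases abs_cases (a - v) with h | h <;> rcases abs_cases (b - v) with h' | h' <;>
      rcases abs_cases ((a + b) / 2 - v) with h'' | h'' <;> linarith
  ext z
  constructor
  · intro hz
    rcases le_total z (proj I v) with h | h
    · exact key _ _ hz hp h
    · exact (key _ _ hp hz h).symm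
  · rintro rfl
    exact hp

/-- The Clarke generalized Jacobian of `f` at `x`: the convex hull of all limits of derivatives
`f'(u_j)` along sequences `u_j → x` of points of differentiability. -/
def clarkeJacobian {E F : Type*} [NormedAddCommGroup E] [NormedSpace ℝ E]
    [NormedAddCommGroup F] [NormedSpace ℝ F] (f : E → F) (x : E) : Set (E →L[ℝ] F) :=
  convexHull ℝ {A | ∃ u : ℕ → E, (∀ j, DifferentiableAt ℝ f (u j)) ∧
    Tendsto u atTop (𝓝 x) ∧ Tendsto (fun j => fderiv ℝ f (u j)) atTop (𝓝 A)}

/-- The Fischer-Burmeister function. -/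
def fischerBurmeister (a b : ℝ) : ℝ := Real.sqrt (a ^ 2 + b ^ 2) - a - b

/-- The support of a vector. -/
def supp {n : ℕ} (x : EuclideanSpace ℝ (Fin n)) : Finset (Fin n) :=
  Finset.univ.filter fun i => x i ≠ 0

/-! ### The space of `Y = (x, ν, μ, λ)` -/

/-- Indices of the coordinates of `(x, ν, μ, λ) ∈ ℝⁿ × ℝⁿ × ℝᵏ × ℝᵐ`. -/
abbrev Idx (n k m : ℕ) : Type := Fin n ⊕ Fin n ⊕ Fin k ⊕ Fin m

/-- `ℝⁿ × ℝⁿ × ℝᵏ × ℝᵐ` with `‖Y‖² = ‖x‖² + ‖ν‖² + ‖μ‖² + ‖λ‖²`. -/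
abbrev YSpace (n k m : ℕ) : Type := EuclideanSpace ℝ (Idx n k m)

section parts
variable {n k m : ℕ}

/-- The component `x` of `Y`. -/
def xPart (Y : YSpace n k m) : EuclideanSpace ℝ (Fin n) :=
  WithLp.toLp 2 fun i => Y (Sum.inl i)

/-- The component `ν` of `Y`. -/
def nuPart (Y : YSpace n k m) : EuclideanSpace ℝ (Fin n) :=
  WithLp.toLp 2 fun i => Y (Sum.inr (Sum.inl i))

/-- The component `μ` of `Y`. -/
def muPart (Y : YSpace n k m) : EuclideanSpace ℝ (Fin k) :=
  WithLp.toLp 2 fun i => Y (Sum.inr (Sum.inr (Sum.inl i)))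

/-- The component `λ` of `Y`. -/
def lamPart (Y : YSpace n k m) : EuclideanSpace ℝ (Fin m) :=
  WithLp.toLp 2 fun j => Y (Sum.inr (Sum.inr (Sum.inr j)))

end parts

/-! ### The sparse quadratically constrained quadratic program -/

/-- The data of the problem: minimize `f₀(x)` subject to `f_i(x) ≤ 0` (`i = 1, …, k`),
`A x - b ≤ 0`, `‖x‖₀ ≤ s` and `x ∈ X₁ × ⋯ × X_n`, where `f_i(x) = ½ xᵀ Q_i x + q_iᵀ x + c_i` with
`Q_i` symmetric and each `X_i` is a closed interval (possibly unbounded) containing `0`. -/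
structure Problem (n k m : ℕ) where
  Q₀ : Matrix (Fin n) (Fin n) ℝ
  q₀ : EuclideanSpace ℝ (Fin n)
  c₀ : ℝ
  Q : Fin k → Matrix (Fin n) (Fin n) ℝ
  q : Fin k → EuclideanSpace ℝ (Fin n)
  c : Fin k → ℝ
  A : Matrix (Fin m) (Fin n) ℝ
  b : Fin m → ℝ
  s : ℕ
  X : Fin n → Set ℝ
  symm₀ : Q₀.IsSymm
  symm : ∀ i, (Q i).IsSymm
  s_le : s ≤ n
  X_closed : ∀ i, IsClosed (X i)
  X_interval : ∀ i, (X i).OrdConnected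
  zero_mem_X : ∀ i, (0 : ℝ) ∈ X i

/-- The quadratic function `½ xᵀ Q x + qᵀ x + c`. -/
def quad {n : ℕ} (Q : Matrix (Fin n) (Fin n) ℝ) (q : EuclideanSpace ℝ (Fin n)) (c : ℝ)
    (x : EuclideanSpace ℝ (Fin n)) : ℝ :=
  (1 / 2) * (x.ofLp ⬝ᵥ Q.mulVec x.ofLp) + q.ofLp ⬝ᵥ x.ofLp + c

/-- The gradient `Q x + q` of `quad Q q c` at `x`, for symmetric `Q`; see `hasGradientAt_quad`. -/
def quadGrad {n : ℕ} (Q : Matrix (Fin n) (Fin n) ℝ) (q : EuclideanSpace ℝ (Fin n))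
    (x : EuclideanSpace ℝ (Fin n)) : EuclideanSpace ℝ (Fin n) :=
  Matrix.toEuclideanCLM (n := Fin n) (𝕜 := ℝ) Q x + q

theorem hasGradientAt_quad {n : ℕ} (Q : Matrix (Fin n) (Fin n) ℝ) (hQ : Q.IsSymm)
    (q : EuclideanSpace ℝ (Fin n)) (c : ℝ) (x : EuclideanSpace ℝ (Fin n)) :
    HasGradientAt (quad Q q c) (quadGrad Q q x) x := by
  rw [hasGradientAt_iff_hasFDerivAt]
  have hL : HasFDerivAt (fun z : EuclideanSpace ℝ (Fin n) =>
      Matrix.toEuclideanCLM (n := Fin n) (𝕜 := ℝ) Q z)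
      (Matrix.toEuclideanCLM (n := Fin n) (𝕜 := ℝ) Q) x := ContinuousLinearMap.hasFDerivAt _
  have h1 := ((hL.inner ℝ (hasFDerivAt_id x)).const_mul (1 / 2 : ℝ)).add
    (((innerSL ℝ q).hasFDerivAt (x := x)).add_const c)
  have hfun : quad Q q c = (fun z => (1 / 2 : ℝ) *
      inner ℝ (Matrix.toEuclideanCLM (n := Fin n) (𝕜 := ℝ) Q z) (id z)) +
      fun z => innerSL ℝ q z + c := by
    funext z
    simp only [quad, Pi.add_apply, id, innerSL_apply_apply, EuclideanSpace.inner_eq_star_dotProduct,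
      Matrix.ofLp_toEuclideanCLM, star_trivial, dotProduct_comm q.ofLp]
    ring
  rw [hfun]
  refine h1.congr_fderiv ?_
  ext v
  have hsym : v.ofLp ⬝ᵥ Q.mulVec x.ofLp = x.ofLp ⬝ᵥ Q.mulVec v.ofLp := by
    rw [Matrix.dotProduct_mulVec, ← Matrix.mulVec_transpose, hQ.eq, dotProduct_comm]
  simp [quadGrad, EuclideanSpace.inner_eq_star_dotProduct, Matrix.ofLp_toEuclideanCLM, hsym]
  ring

namespace Problem

variable {n k m : ℕ} (P : Problem n k m)

/-- The constraint function `f_i`, `i = 1, …, k`. -/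
def f (i : Fin k) (x : EuclideanSpace ℝ (Fin n)) : ℝ := quad (P.Q i) (P.q i) (P.c i) x

/-- The gradient of `f_i`. -/
def gradf (i : Fin k) (x : EuclideanSpace ℝ (Fin n)) : EuclideanSpace ℝ (Fin n) :=
  quadGrad (P.Q i) (P.q i) x

/-- The inner product `⟨a_j, x⟩` of the `j`-th row of `A` with `x`. -/
def lin (j : Fin m) (x : EuclideanSpace ℝ (Fin n)) : ℝ := P.A j ⬝ᵥ x.ofLp

/-- The Lagrangian `L(x, μ, λ) = f₀(x) + ∑ μ_i f_i(x) + ⟨λ, A x - b⟩`. -/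
def lagrangian (x : EuclideanSpace ℝ (Fin n)) (μ : EuclideanSpace ℝ (Fin k))
    (l : EuclideanSpace ℝ (Fin m)) : ℝ :=
  quad P.Q₀ P.q₀ P.c₀ x + ∑ i, μ i * P.f i x + ∑ j, l j * (P.lin j x - P.b j)

/-- The gradient `∇ₓL(x, μ, λ)`; see `hasGradientAt_lagrangian`. -/
def gradL (x : EuclideanSpace ℝ (Fin n)) (μ : EuclideanSpace ℝ (Fin k))
    (l : EuclideanSpace ℝ (Fin m)) : EuclideanSpace ℝ (Fin n) :=
  quadGrad P.Q₀ P.q₀ x + ∑ i, μ i • P.gradf i x + ∑ j, l j • WithLp.toLp 2 (P.A j)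

/-- The Hessian `∇²ₓₓL(x, μ, λ)`, which depends on `μ` only; see `hasFDerivAt_gradL`. -/
def hessL (μ : EuclideanSpace ℝ (Fin k)) : Matrix (Fin n) (Fin n) ℝ :=
  P.Q₀ + ∑ i, μ i • P.Q i

theorem hasGradientAt_lagrangian (x : EuclideanSpace ℝ (Fin n)) (μ : EuclideanSpace ℝ (Fin k))
    (l : EuclideanSpace ℝ (Fin m)) :
    HasGradientAt (fun z => P.lagrangian z μ l) (P.gradL x μ l) x := by
  have h0 := (hasGradientAt_quad P.Q₀ P.symm₀ P.q₀ P.c₀ x).hasFDerivAt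
  have h1 := HasFDerivAt.fun_sum (u := Finset.univ) fun i _ =>
    (hasGradientAt_quad (P.Q i) (P.symm i) (P.q i) (P.c i) x).hasFDerivAt.const_mul (μ i)
  have h2 := HasFDerivAt.fun_sum (u := Finset.univ) fun j _ =>
    (((innerSL ℝ (WithLp.toLp 2 (P.A j))).hasFDerivAt (x := x)).sub_const (P.b j)).const_mul (l j)
  rw [hasGradientAt_iff_hasFDerivAt]
  have h := (h0.add h1).add h2
  have hfun : (fun z => P.lagrangian z μ l) = (quad P.Q₀ P.q₀ P.c₀ +
      (fun z => ∑ i, μ i * quad (P.Q i) (P.q i) (P.c i) z)) +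
      fun z => ∑ j, l j * (innerSL ℝ (WithLp.toLp 2 (P.A j)) z - P.b j) := by
    funext z
    simp [lagrangian, f, lin, EuclideanSpace.inner_eq_star_dotProduct,
      dotProduct_comm z.ofLp]
  rw [hfun]
  refine h.congr_fderiv ?_
  ext v
  simp [gradL, gradf]

theorem hasFDerivAt_gradL (x : EuclideanSpace ℝ (Fin n)) (μ : EuclideanSpace ℝ (Fin k))
    (l : EuclideanSpace ℝ (Fin m)) :
    HasFDerivAt (fun z => P.gradL z μ l)
      (Matrix.toEuclideanCLM (n := Fin n) (𝕜 := ℝ) (P.hessL μ)) x := by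
  have h0 := ((Matrix.toEuclideanCLM (n := Fin n) (𝕜 := ℝ) P.Q₀).hasFDerivAt (x := x)).add_const
    P.q₀
  have h1 := HasFDerivAt.fun_sum (u := Finset.univ) fun i _ =>
    (((Matrix.toEuclideanCLM (n := Fin n) (𝕜 := ℝ) (P.Q i)).hasFDerivAt (x := x)).add_const
      (P.q i)).const_smul (μ i)
  refine ((h0.add h1).add_const (∑ j, l j • WithLp.toLp 2 (P.A j))).congr_fderiv ?_
  simp [hessL, map_add, map_sum, map_smul]

/-- The set `𝔽` of points satisfying the quadratic and the linear constraints. -/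
def feasF : Set (EuclideanSpace ℝ (Fin n)) :=
  {x | (∀ i, P.f i x ≤ 0) ∧ ∀ j, P.lin j x - P.b j ≤ 0}

/-- The sparse set `𝕊 = {x : ‖x‖₀ ≤ s}`. -/
def sparse : Set (EuclideanSpace ℝ (Fin n)) := {x | (supp x).card ≤ P.s}

/-- `𝕁_s(x)`: the index sets of cardinality `s` that contain the support of `x`. -/
def Js (x : EuclideanSpace ℝ (Fin n)) : Set (Finset (Fin n)) :=
  {J | J.card = P.s ∧ supp x ⊆ J}

/-- `Y = (x, ν, μ, λ)` satisfies the P-stationarity conditions with constant `τ`. The first one says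
that `x` is the (unique) projection of `x - τ (∇ₓL(x, μ, λ) + ν)` onto the sparse set. -/
structure IsPStationary (τ : ℝ) (Y : YSpace n k m) : Prop where
  sparse_proj : projSet P.sparse
    (xPart Y - τ • (P.gradL (xPart Y) (muPart Y) (lamPart Y) + nuPart Y)) = {xPart Y}
  box_proj : ∀ i ∈ supp (xPart Y), xPart Y i = proj (P.X i) (xPart Y i + nuPart Y i)
  nu_zero : ∀ i ∉ supp (xPart Y), nuPart Y i = 0
  quad_le : ∀ i, P.f i (xPart Y) ≤ 0
  mu_nonneg : ∀ i, 0 ≤ muPart Y i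
  mu_compl : ∀ i, muPart Y i * P.f i (xPart Y) = 0
  lin_le : ∀ j, P.lin j (xPart Y) - P.b j ≤ 0
  lam_nonneg : ∀ j, 0 ≤ lamPart Y j
  lam_compl : ∑ j, lamPart Y j * (P.lin j (xPart Y) - P.b j) = 0

/-- The restricted LICQ at `x`: `x` is feasible and, with `Γ = supp x`, for every `T ∈ 𝕁_s(x)` the
vectors `(∇f_i(x))_Γ` (`f_i(x) = 0`), `(a_j)_Γ` (`⟨a_j, x⟩ = b_j`) and `(e_i)_Γ`
(`i ∈ T`, `x_i ∈ bd X_i`) form a linearly independent family. -/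
def RestrictedLICQ (x : EuclideanSpace ℝ (Fin n)) : Prop :=
  (x ∈ P.feasF ∧ x ∈ P.sparse ∧ ∀ i, x i ∈ P.X i) ∧
  ∀ T ∈ P.Js x,
    LinearIndependent ℝ
      (Sum.elim (fun i : {i : Fin k // P.f i x = 0} =>
          fun r : {r // r ∈ supp x} => P.gradf i x r)
        (Sum.elim (fun j : {j : Fin m // P.lin j x = P.b j} =>
            fun r : {r // r ∈ supp x} => P.A j r)
          (fun i : {i : Fin n // i ∈ T ∧ x i ∈ frontier (P.X i)} =>
            fun r : {r // r ∈ supp x} => (Pi.single (i : Fin n) (1 : ℝ) : Fin n → ℝ) r)))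

/-- The vector `u = x - τ (∇ₓL(x, μ, λ) + ν)`. -/
def uVec (τ : ℝ) (Y : YSpace n k m) : EuclideanSpace ℝ (Fin n) :=
  xPart Y - τ • (P.gradL (xPart Y) (muPart Y) (lamPart Y) + nuPart Y)

/-- `𝕋_τ(Y)`: the index sets of `s` largest entries of `u` in absolute value. -/
def TSet (τ : ℝ) (Y : YSpace n k m) : Set (Finset (Fin n)) :=
  {T | T.card = P.s ∧ ∀ i ∈ T, ∀ j ∉ T, |P.uVec τ Y j| ≤ |P.uVec τ Y i|}

/-- The cone `ℚ(Y; T)`: the `d ∈ ℝⁿ` with `⟨∇f_i(x), d⟩ = 0` where `μ_i > 0`, `f_i(x) = 0`, with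
`⟨a_j, d⟩ = 0` where `λ_j > 0`, `⟨a_j, x⟩ = b_j`, and with `d_i = 0` where `i ∈ T`, `ν_i ≠ 0`,
`x_i ∈ bd X_i`. -/
def coneQ (Y : YSpace n k m) (T : Finset (Fin n)) : Set (EuclideanSpace ℝ (Fin n)) :=
  {d | (∀ i, 0 < muPart Y i → P.f i (xPart Y) = 0 → inner ℝ (P.gradf i (xPart Y)) d = 0) ∧
    (∀ j, 0 < lamPart Y j → P.lin j (xPart Y) = P.b j → P.lin j d = 0) ∧
    ∀ i ∈ T, nuPart Y i ≠ 0 → xPart Y i ∈ frontier (P.X i) → d i = 0}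

/-- The strong second-order condition: the Hessian of the Lagrangian is positive definite on
`ℚ(Y; T)`. -/
def StrongSOC (Y : YSpace n k m) (T : Finset (Fin n)) : Prop :=
  ∀ d ∈ P.coneQ Y T, d ≠ 0 → 0 < d.ofLp ⬝ᵥ (P.hessL (muPart Y)).mulVec d.ofLp

/-- The map `F(·; T)` of the stationary equations. Its blocks `(∇ₓL + ν)_T`, `x_{T̄}`,
`x_T - Π_{X_T}(x_T + ν_T)`, `ν_{T̄}`, `φ(x, μ)`, `ψ(x, λ)` are listed in the order in which the first
two, and the next two, are merged into one block indexed by `[n]`. The projection onto the box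
`X_T` acts coordinatewise. -/
def F (T : Finset (Fin n)) (Y : YSpace n k m) : YSpace n k m :=
  WithLp.toLp 2
    (Sum.elim
      (fun i => if i ∈ T then P.gradL (xPart Y) (muPart Y) (lamPart Y) i + nuPart Y i
        else xPart Y i)
    (Sum.elim
      (fun i => if i ∈ T then xPart Y i - proj (P.X i) (xPart Y i + nuPart Y i)
        else nuPart Y i)
    (Sum.elim
      (fun i => fischerBurmeister (-(P.f i (xPart Y))) (muPart Y i))
      (fun j => fischerBurmeister (P.b j - P.lin j (xPart Y)) (lamPart Y j)))))

/-- The generalized Jacobian `∂F(Y; T)`, as a set of matrices. -/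
def genJac (T : Finset (Fin n)) (Y : YSpace n k m) :
    Set (Matrix (Idx n k m) (Idx n k m) ℝ) :=
  {W | Matrix.toEuclideanCLM (n := Idx n k m) (𝕜 := ℝ) W ∈ clarkeJacobian (P.F T) Y}

/-- The merit function `Ψ(Y; T) = ½ ‖F(Y; T)‖²`. -/
def merit (T : Finset (Fin n)) (Y : YSpace n k m) : ℝ := (1 / 2) * ‖P.F T Y‖ ^ 2

end Problem

/-! ### The algorithm -/

section algorithm
variable {n k m : ℕ}

/-- The index set `K` of the coordinates `(x_T, ν_T, μ, λ)`. -/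
def KSet (k m : ℕ) (T : Finset (Fin n)) : Finset (Idx n k m) :=
  T.disjSum (T.disjSum (Finset.univ.disjSum Finset.univ))

/-- The reduced matrix `G`: the rows and columns of `W` indexed by `K`. -/
def matG (T : Finset (Fin n)) (W : Matrix (Idx n k m) (Idx n k m) ℝ) :
    Matrix {r // r ∈ KSet k m T} {r // r ∈ KSet k m T} ℝ :=
  W.submatrix Subtype.val Subtype.val

/-- The matrix `D`: the rows of `W` indexed by `K` and its columns belonging to `x_{T̄}`. -/
def matD (T : Finset (Fin n)) (W : Matrix (Idx n k m) (Idx n k m) ℝ) :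
    Matrix {r // r ∈ KSet k m T} {j // j ∉ T} ℝ :=
  W.submatrix Subtype.val fun j => Sum.inl (j : Fin n)

/-- The right-hand side `D x_{T̄} - F(Y; T)_K` of the reduced Newton equation. -/
def newtonRhs (P : Problem n k m) (T : Finset (Fin n)) (Y : YSpace n k m)
    (W : Matrix (Idx n k m) (Idx n k m) ℝ) : {r // r ∈ KSet k m T} → ℝ :=
  (matD T W).mulVec (fun j : {j // j ∉ T} => xPart Y j) -
    fun r : {r // r ∈ KSet k m T} => P.F T Y r

/-- The damped direction `d(α) = (d_{T̄}; d_J; α d_K)`. -/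
def damped (T : Finset (Fin n)) (α : ℝ) (d : YSpace n k m) : YSpace n k m :=
  WithLp.toLp 2 fun r => if r ∈ KSet k m T then α * d r else d r

/-- The Armijo condition at the trial exponent `t`. -/
def Armijo (P : Problem n k m) (ρ σ : ℝ) (Y : YSpace n k m) (T : Finset (Fin n))
    (W : Matrix (Idx n k m) (Idx n k m) ℝ) (d : YSpace n k m) (t : ℕ) : Prop :=
  P.merit T (Y + damped T (ρ ^ t) d) ≤
    P.merit T Y + σ * ρ ^ t *
      inner ℝ (P.F T Y) (Matrix.toEuclideanCLM (n := Idx n k m) (𝕜 := ℝ) W d)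

/-- One iteration of SNSQP from `Y` with index set `T` and regularization parameter `κ`: the chosen
generalized Jacobian is `W`, the computed direction `d`, the line search exponent `t`, and the new
point `Y'`. The reduced Newton equation `G d_K = D x_{T̄} - F(Y; T)_K` is used if it is solvable, and
its regularized normal equation otherwise. -/
structure IsStep (P : Problem n k m) (ρ σ κ : ℝ) (Y : YSpace n k m) (T : Finset (Fin n))
    (W : Matrix (Idx n k m) (Idx n k m) ℝ) (d : YSpace n k m) (t : ℕ) (Y' : YSpace n k m) :
    Prop where
  jac : W ∈ P.genJac T Y
  dir_x : ∀ i ∉ T, xPart d i = -xPart Y i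
  dir_nu : ∀ i ∉ T, nuPart d i = -nuPart Y i
  dir_solvable : (∃ z, (matG T W).mulVec z = newtonRhs P T Y W) →
    (matG T W).mulVec (fun r : {r // r ∈ KSet k m T} => d r) = newtonRhs P T Y W
  dir_regularized : (¬ ∃ z, (matG T W).mulVec z = newtonRhs P T Y W) →
    ((matG T W).transpose * matG T W + κ • 1).mulVec (fun r : {r // r ∈ KSet k m T} => d r) =
      (matG T W).transpose.mulVec (newtonRhs P T Y W)
  line_search : IsLeast {t | Armijo P ρ σ Y T W d t} t
  update : Y' = Y + damped T (ρ ^ t) d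

/-- The first `N ≤ ∞` iterations of a run of SNSQP with tolerance `ε`: an iteration is performed
only while `‖F(Y^ℓ; T_ℓ)‖ > ε`, and each new index set is an arbitrary element of `𝕋_τ(Y^{ℓ+1})`. -/
structure IsRun (P : Problem n k m) (τ ρ σ ε : ℝ) (κ : ℕ → ℝ) (N : ℕ∞) (Y : ℕ → YSpace n k m)
    (T : ℕ → Finset (Fin n)) (W : ℕ → Matrix (Idx n k m) (Idx n k m) ℝ)
    (d : ℕ → YSpace n k m) (t : ℕ → ℕ) : Prop where
  init : T 0 ∈ P.TSet τ (Y 0)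
  not_stopped : ∀ l : ℕ, (l : ℕ∞) < N → ε < ‖P.F (T l) (Y l)‖
  step : ∀ l : ℕ, (l : ℕ∞) < N →
    IsStep P ρ σ (κ l) (Y l) (T l) (W l) (d l) (t l) (Y (l + 1))
  index : ∀ l : ℕ, (l : ℕ∞) < N → T (l + 1) ∈ P.TSet τ (Y (l + 1))

end algorithm

end SNSQP

end

/-!
Near `Y*` the method is a Newton method for a fixed equation, up to the choice among finitely many
index sets. Unique projection onto the sparse set separates the entries of `u` on the support of
`x*` from the others, so every `T ∈ 𝕋_τ(Y)` with `Y` near `Y*` contains the support and belongs to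
`𝕋_τ(Y*)` (`eventually_TSet_subset`); for such `T` one has `F(Y*; T) = 0` (`F_eq_zero`).

Elements of the Clarke generalized Jacobian are handled through an explicit family of linear maps
`modelJac T Y p`, obtained from the chain rule with generalized derivatives `p` of the scalar
projections and of the Fischer-Burmeister function. The conditions on `p` (`IsSelection`) are closed
in `(Y, p)` and convex in `p`, and hold wherever `F` is differentiable (`fderiv_F_eq_modelJac`), so
limits and convex combinations of derivatives are again of this form
(`clarkeJacobian_subset_model`). Two facts about the model carry the Newton argument.

* Nonsingularity: if a model Jacobian at `Y*` annihilates a direction, pairing its first rows with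
  the `x`-part of the direction gives `dᵀ ∇²L d` plus nonnegative terms equal to zero. The second-order
  condition forces `d = 0` and the restricted LICQ the rest (`modelJac_injective`). Compactness of
  the set of coefficients makes this uniform near `Y*` (`exists_modelJac_lower_bound`).
* Quadratic error: the linearization of `F` at `Y` predicts the zero `Y*` up to `O(‖Y - Y*‖²)`
  (`exists_modelJac_error_bound`). The projections contribute no error, being affine on each side
  of the point in question, and for the Fischer-Burmeister function this follows from Euler's
  relation; the smooth parts are quadratic polynomials.

The rows of `K` do not involve `ν_{T̄}`, so the reduced equation is equivalent to the full Newton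
equation (`reduced_equation_iff`). Hence the step is a Newton step with quadratic error, and since
`‖F‖` is comparable with the distance to `Y*`, the merit function decreases enough for the exponent
`0` to be accepted when `σ < 1/2` (`armijo_zero`). The generalized Jacobian is nonempty by
Rademacher's theorem (`clarkeJacobian_nonempty`).
-/

namespace SNSQP

/-! ### The projection onto a closed interval -/

section Projection

variable {I : Set ℝ}

theorem proj_mem_projSet (hc : IsClosed I) (ho : I.OrdConnected) (hne : I.Nonempty) (v : ℝ) :
    proj I v ∈ projSet I v := by
  rw [projSet_eq_singleton hc ho hne v]; rfl

/-- The variational inequality characterizing the projection. -/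
theorem proj_variational (hc : IsClosed I) (ho : I.OrdConnected) (hne : I.Nonempty) (v : ℝ)
    {w : ℝ} (hw : w ∈ I) : (v - proj I v) * (w - proj I v) ≤ 0 := by
  obtain ⟨hp, hmin⟩ := proj_mem_projSet hc ho hne v
  have hdist := hmin w hw
  simp only [Real.norm_eq_abs] at hdist
  by_contra! hpos
  -- if `w` lay strictly on the side of `v`, then one of `v`, `w` would be a closer point of `I`
  rcases mul_pos_iff.1 hpos with ⟨h1, h2⟩ | ⟨h1, h2⟩
  · rcases le_total v w with h | h
    · have h3 := hmin v (ho.out hp hw ⟨by linarith, h⟩)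
      simp only [Real.norm_eq_abs, sub_self, abs_zero] at h3
      have := abs_eq_zero.1 (le_antisymm h3 (abs_nonneg _))
      linarith
    · rw [abs_of_neg (by linarith : proj I v - v < 0),
        abs_of_nonpos (by linarith : w - v ≤ 0)] at hdist
      linarith
  · rcases le_total v w with h | h
    · rw [abs_of_pos (by linarith : 0 < proj I v - v),
        abs_of_nonneg (by linarith : 0 ≤ w - v)] at hdist
      linarith
    · have h3 := hmin v (ho.out hw hp ⟨h, by linarith⟩)
      simp only [Real.norm_eq_abs, sub_self, abs_zero] at h3
      have := abs_eq_zero.1 (le_antisymm h3 (abs_nonneg _))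
      linarith

theorem proj_eq_of_variational (hc : IsClosed I) (ho : I.OrdConnected) {v p : ℝ} (hp : p ∈ I)
    (h : ∀ w ∈ I, (v - p) * (w - p) ≤ 0) : proj I v = p := by
  have h1 := proj_variational hc ho ⟨p, hp⟩ v hp
  have h2 := h _ (proj_mem_projSet hc ho ⟨p, hp⟩ v).1
  nlinarith [sq_nonneg (proj I v - p)]

theorem proj_of_mem (hc : IsClosed I) (ho : I.OrdConnected) {v : ℝ} (hv : v ∈ I) :
    proj I v = v :=
  proj_eq_of_variational hc ho hv fun w _ => by simp

/-- Firm nonexpansiveness of the projection. -/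
theorem proj_firm (hc : IsClosed I) (ho : I.OrdConnected) (hne : I.Nonempty) (v w : ℝ) :
    (proj I v - proj I w) ^ 2 ≤ (v - w) * (proj I v - proj I w) := by
  have h1 := proj_variational hc ho hne v (proj_mem_projSet hc ho hne w).1
  have h2 := proj_variational hc ho hne w (proj_mem_projSet hc ho hne v).1
  nlinarith

theorem proj_monotone (hc : IsClosed I) (ho : I.OrdConnected) (hne : I.Nonempty) :
    Monotone (proj I) := by
  intro v w hvw
  have h := proj_firm hc ho hne v w
  by_contra! hlt
  nlinarith

theorem sub_proj_monotone (hc : IsClosed I) (ho : I.OrdConnected) (hne : I.Nonempty) :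
    Monotone fun v => v - proj I v := by
  intro v w hvw
  have h := proj_firm hc ho hne v w
  have h' := proj_monotone hc ho hne hvw
  by_contra! hlt
  nlinarith

theorem proj_lipschitz (hc : IsClosed I) (ho : I.OrdConnected) (hne : I.Nonempty) :
    LipschitzWith 1 (proj I) := by
  refine LipschitzWith.of_dist_le_mul fun v w => ?_
  rw [NNReal.coe_one, one_mul, Real.dist_eq, Real.dist_eq]
  rcases le_total v w with h | h
  · have h1 := proj_monotone hc ho hne h
    have h2 := sub_proj_monotone hc ho hne h
    simp only at h2
    rw [abs_of_nonpos (by linarith), abs_of_nonpos (by linarith)]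
    linarith
  · have h1 := proj_monotone hc ho hne h
    have h2 := sub_proj_monotone hc ho hne h
    simp only at h2
    rw [abs_of_nonneg (by linarith), abs_of_nonneg (by linarith)]
    linarith

theorem deriv_proj_mem_Icc (hc : IsClosed I) (ho : I.OrdConnected) (hne : I.Nonempty)
    {v δ : ℝ} (h : HasDerivAt (proj I) δ v) : δ ∈ Set.Icc (0 : ℝ) 1 := by
  refine ⟨h.nonneg_of_monotone (proj_monotone hc ho hne), ?_⟩
  have := ((hasDerivAt_id v).sub h).nonneg_of_monotone (sub_proj_monotone hc ho hne)
  linarith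

/-- A point whose projection is an interior point is its own projection. -/
theorem eq_proj_of_proj_mem_interior (hc : IsClosed I) (ho : I.OrdConnected) {v : ℝ}
    (h : proj I v ∈ interior I) : proj I v = v := by
  have hp := interior_subset h
  obtain ⟨ε, hε, hball⟩ := Metric.isOpen_iff.1 isOpen_interior _ h
  have h1 : ∀ s : ℝ, |s| < ε → (v - proj I v) * s ≤ 0 := by
    intro s hs
    have hm : proj I v + s ∈ I := interior_subset (hball (by simpa [Real.dist_eq] using hs))
    simpa using proj_variational hc ho ⟨_, hp⟩ v hm
  have h2 := h1 (ε / 2) (by rw [abs_of_pos] <;> linarith)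
  have h3 := h1 (-(ε / 2)) (by rw [abs_neg, abs_of_pos] <;> linarith)
  nlinarith

/-- Outside of the closed interval the projection is locally constant. -/
theorem proj_eventually_const (hc : IsClosed I) (ho : I.OrdConnected) (hne : I.Nonempty)
    {v₀ : ℝ} (hv₀ : v₀ ∉ I) : ∀ᶠ v in 𝓝 v₀, proj I v = proj I v₀ := by
  have hp := (proj_mem_projSet hc ho hne v₀).1
  have hne' : proj I v₀ ≠ v₀ := fun h => hv₀ (h ▸ hp)
  rcases lt_or_gt_of_ne hne' with h | h
  · filter_upwards [lt_mem_nhds h] with v hv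
    refine proj_eq_of_variational hc ho hp fun w hw => ?_
    have := proj_variational hc ho hne v₀ hw
    have h2 : w - proj I v₀ ≤ 0 := by by_contra! h2; nlinarith
    nlinarith
  · filter_upwards [gt_mem_nhds h] with v hv
    refine proj_eq_of_variational hc ho hp fun w hw => ?_
    have := proj_variational hc ho hne v₀ hw
    have h2 : 0 ≤ w - proj I v₀ := by by_contra! h2; nlinarith
    nlinarith

theorem proj_eventually_id (hc : IsClosed I) (ho : I.OrdConnected) {v₀ : ℝ}
    (hv₀ : v₀ ∈ interior I) : ∀ᶠ v in 𝓝 v₀, proj I v = v := by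
  filter_upwards [isOpen_interior.mem_nhds hv₀] with v hv
  exact proj_of_mem hc ho (interior_subset hv)

/-- Near `v₀` the projection is affine on either side of `v₀`, so wherever it is differentiable its
derivative `δ` reproduces the increment from `v₀` exactly. -/
theorem deriv_proj_near (hc : IsClosed I) (ho : I.OrdConnected) (hne : I.Nonempty) (v₀ : ℝ) :
    ∀ᶠ v in 𝓝 v₀, ∀ δ, HasDerivAt (proj I) δ v →
      δ * (v - v₀) = proj I v - proj I v₀ ∧ (v₀ ∉ I → δ = 0) ∧ (v₀ ∈ interior I → δ = 1) := by
  by_cases hv₀ : v₀ ∈ I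
  swap
  · have hconst := proj_eventually_const hc ho hne hv₀
    filter_upwards [hconst, hconst.eventually_nhds] with v hv hv' δ hδ
    have h0 : δ = 0 := hδ.unique ((hasDerivAt_const v (proj I v₀)).congr_of_eventuallyEq hv')
    exact ⟨by rw [h0, hv]; ring, fun _ => h0, fun h => absurd (interior_subset h) hv₀⟩
  have hp₀ := proj_of_mem hc ho hv₀
  -- on each side the slope is `1` or `0`, according to whether `I` has points on that side
  have hright : ∀ᶠ v in 𝓝 v₀, v₀ < v → ∀ δ, HasDerivAt (proj I) δ v →
      δ * (v - v₀) = proj I v - proj I v₀ := by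
    by_cases hw : ∃ w ∈ I, v₀ < w
    · obtain ⟨w, hw, hlt⟩ := hw
      filter_upwards [gt_mem_nhds hlt] with v hv hv' δ hδ
      have hid : ∀ᶠ z in 𝓝 v, proj I z = z := by
        filter_upwards [Ioo_mem_nhds hv' hv] with z hz
        exact proj_of_mem hc ho (ho.out hv₀ hw ⟨hz.1.le, hz.2.le⟩)
      rw [hδ.unique ((hasDerivAt_id v).congr_of_eventuallyEq hid), hid.self_of_nhds, hp₀, one_mul]
    · push Not at hw
      have hc' : ∀ z, v₀ < z → proj I z = v₀ := fun z hz =>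
        proj_eq_of_variational hc ho hv₀ fun w hwI => by nlinarith [hw w hwI]
      refine .of_forall fun v hv δ hδ => ?_
      have hev : ∀ᶠ z in 𝓝 v, proj I z = v₀ := by
        filter_upwards [lt_mem_nhds hv] with z hz using hc' z hz
      rw [hδ.unique ((hasDerivAt_const v v₀).congr_of_eventuallyEq hev), hc' v hv, hp₀]
      ring
  have hleft : ∀ᶠ v in 𝓝 v₀, v < v₀ → ∀ δ, HasDerivAt (proj I) δ v →
      δ * (v - v₀) = proj I v - proj I v₀ := by
    by_cases hw : ∃ w ∈ I, w < v₀
    · obtain ⟨w, hw, hlt⟩ := hw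
      filter_upwards [lt_mem_nhds hlt] with v hv hv' δ hδ
      have hid : ∀ᶠ z in 𝓝 v, proj I z = z := by
        filter_upwards [Ioo_mem_nhds hv hv'] with z hz
        exact proj_of_mem hc ho (ho.out hw hv₀ ⟨hz.1.le, hz.2.le⟩)
      rw [hδ.unique ((hasDerivAt_id v).congr_of_eventuallyEq hid), hid.self_of_nhds, hp₀, one_mul]
    · push Not at hw
      have hc' : ∀ z, z < v₀ → proj I z = v₀ := fun z hz =>
        proj_eq_of_variational hc ho hv₀ fun w hwI => by nlinarith [hw w hwI]
      refine .of_forall fun v hv δ hδ => ?_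
      have hev : ∀ᶠ z in 𝓝 v, proj I z = v₀ := by
        filter_upwards [gt_mem_nhds hv] with z hz using hc' z hz
      rw [hδ.unique ((hasDerivAt_const v v₀).congr_of_eventuallyEq hev), hc' v hv, hp₀]
      ring
  have hint : ∀ᶠ v in 𝓝 v₀, ∀ δ, HasDerivAt (proj I) δ v → v₀ ∈ interior I → δ = 1 := by
    by_cases hi : v₀ ∈ interior I
    · filter_upwards [(proj_eventually_id hc ho hi).eventually_nhds] with v hv δ hδ _
      exact hδ.unique ((hasDerivAt_id v).congr_of_eventuallyEq hv)
    · exact .of_forall fun v δ _ h => absurd h hi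
  filter_upwards [hright, hleft, hint] with v hr hl hi δ hδ
  refine ⟨?_, fun h => absurd hv₀ h, hi δ hδ⟩
  rcases lt_trichotomy v v₀ with h | h | h
  · exact hl h δ hδ
  · rw [h]; ring
  · exact hr h δ hδ

end Projection

/-! ### The Fischer-Burmeister function -/

section FischerBurmeister

/-- `q` belongs to the generalized gradient of the Fischer-Burmeister function at `(a, b)`: away
from the origin `q` is the gradient, and at the origin `q + (1, 1)` is any vector of the closed
unit disc. The equations are multiplied by `√(a² + b²)`, which makes the relation closed in
`(a, b, q)` and convex in `q`. -/
def IsFBGrad (a b : ℝ) (q : ℝ × ℝ) : Prop :=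
  (q.1 + 1) ^ 2 + (q.2 + 1) ^ 2 ≤ 1 ∧
    q.1 * √(a ^ 2 + b ^ 2) = a - √(a ^ 2 + b ^ 2) ∧ q.2 * √(a ^ 2 + b ^ 2) = b - √(a ^ 2 + b ^ 2)

theorem IsFBGrad.nonpos {a b : ℝ} {q : ℝ × ℝ} (h : IsFBGrad a b q) : q.1 ≤ 0 ∧ q.2 ≤ 0 := by
  have := h.1
  constructor <;> nlinarith [sq_nonneg (q.1 + 1), sq_nonneg (q.2 + 1)]

theorem IsFBGrad.abs_le {a b : ℝ} {q : ℝ × ℝ} (h : IsFBGrad a b q) : |q.1| ≤ 2 ∧ |q.2| ≤ 2 := by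
  have := h.1
  obtain ⟨h1, h2⟩ := h.nonpos
  constructor <;> rw [_root_.abs_le] <;> constructor <;>
    nlinarith [sq_nonneg (q.1 + 1), sq_nonneg (q.2 + 1)]

/-- Euler's relation for the positively homogeneous Fischer-Burmeister function. -/
theorem IsFBGrad.euler {a b : ℝ} {q : ℝ × ℝ} (h : IsFBGrad a b q) :
    fischerBurmeister a b = q.1 * a + q.2 * b := by
  obtain ⟨-, h1, h2⟩ := h
  unfold fischerBurmeister
  have hr0 := Real.sqrt_nonneg (a ^ 2 + b ^ 2)
  have hr := Real.sq_sqrt (by positivity : 0 ≤ a ^ 2 + b ^ 2)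
  set r := √(a ^ 2 + b ^ 2)
  rcases hr0.eq_or_lt with h0 | h0
  · have ha : a = 0 := by nlinarith [sq_nonneg a, sq_nonneg b]
    have hb : b = 0 := by nlinarith [sq_nonneg a, sq_nonneg b]
    rw [← h0, ha, hb]; ring
  · have : r * (r - a - b) = r * (q.1 * a + q.2 * b) := by linear_combination hr - a * h1 - b * h2
    exact mul_left_cancel₀ h0.ne' this

theorem fischerBurmeister_eq_zero {a b : ℝ} (ha : 0 ≤ a) (hb : 0 ≤ b) (hab : a * b = 0) :
    fischerBurmeister a b = 0 := by
  unfold fischerBurmeister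
  rw [show a ^ 2 + b ^ 2 = (a + b) ^ 2 by linear_combination -2 * hab,
    Real.sqrt_sq (by linarith)]
  ring

/-- Convex combinations of generalized gradients at a fixed point are generalized gradients. -/
theorem IsFBGrad.convex {a b s t : ℝ} {q q' : ℝ × ℝ} (h : IsFBGrad a b q) (h' : IsFBGrad a b q')
    (hs : 0 ≤ s) (ht : 0 ≤ t) (hst : s + t = 1) : IsFBGrad a b (s • q + t • q') := by
  obtain ⟨h1, h2, h3⟩ := h
  obtain ⟨h1', h2', h3'⟩ := h'
  have ht' : t = 1 - s := by linarith
  subst ht'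
  refine ⟨?_, ?_, ?_⟩
  · simp only [Prod.fst_add, Prod.snd_add, Prod.smul_fst, Prod.smul_snd, smul_eq_mul]
    have h4 := mul_nonneg hs (sub_nonneg.2 h1)
    have h5 := mul_nonneg ht (sub_nonneg.2 h1')
    have h6 := mul_nonneg (mul_nonneg hs ht)
      (add_nonneg (sq_nonneg (q.1 - q'.1)) (sq_nonneg (q.2 - q'.2)))
    nlinarith
  · simp only [Prod.fst_add, Prod.smul_fst, smul_eq_mul]
    linear_combination s * h2 + (1 - s) * h2'
  · simp only [Prod.snd_add, Prod.smul_snd, smul_eq_mul]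
    linear_combination s * h3 + (1 - s) * h3'

/-- If `a > 0` is large compared with `b`, the first partial derivative is `O(b²)`. -/
theorem IsFBGrad.fst_bound {a b : ℝ} {q : ℝ × ℝ} (h : IsFBGrad a b q) {a₀ : ℝ} (ha₀ : 0 < a₀)
    (ha : a₀ / 2 < a) : |q.1 * a₀| ≤ 4 / a₀ * b ^ 2 := by
  obtain ⟨-, h1, -⟩ := h
  have hapos : 0 < a := by linarith
  have hr0 : 0 < √(a ^ 2 + b ^ 2) := Real.sqrt_pos.2 (by positivity)
  have hr := Real.sq_sqrt (by positivity : 0 ≤ a ^ 2 + b ^ 2)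
  set r := √(a ^ 2 + b ^ 2)
  have hra : a ≤ r := by nlinarith [sq_nonneg b]
  -- `-q₁ = (r - a) / r = b² / (r (r + a))`
  have hq : -q.1 * (r * (r + a)) = b ^ 2 := by linear_combination hr - (r + a) * h1
  have hden : a₀ ^ 2 / 4 ≤ r * (r + a) := by nlinarith
  have hq0 : 0 ≤ -q.1 := by
    by_contra! hneg
    nlinarith [sq_nonneg b, mul_pos hr0 (by linarith : 0 < r + a)]
  rw [abs_mul, abs_of_pos ha₀, ← abs_neg, abs_of_nonneg hq0, div_mul_eq_mul_div, le_div_iff₀ ha₀]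
  nlinarith

theorem IsFBGrad.swap {a b : ℝ} {q : ℝ × ℝ} (h : IsFBGrad a b q) : IsFBGrad b a q.swap := by
  obtain ⟨h1, h2, h3⟩ := h
  refine ⟨by simpa [add_comm] using h1, ?_, ?_⟩ <;> rw [add_comm (b ^ 2)]
  exacts [h3, h2]

theorem IsFBGrad.snd_bound {a b : ℝ} {q : ℝ × ℝ} (h : IsFBGrad a b q) {b₀ : ℝ} (hb₀ : 0 < b₀)
    (hb : b₀ / 2 < b) : |q.2 * b₀| ≤ 4 / b₀ * a ^ 2 :=
  h.swap.fst_bound hb₀ hb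

theorem sqrt_sq_add_zero {a : ℝ} (ha : 0 ≤ a) : √(a ^ 2 + 0 ^ 2) = a := by
  rw [zero_pow two_ne_zero, add_zero, Real.sqrt_sq ha]

theorem IsFBGrad.of_pos_zero {a : ℝ} {q : ℝ × ℝ} (ha : 0 < a) (h : IsFBGrad a 0 q) :
    q.1 = 0 ∧ q.2 = -1 := by
  obtain ⟨-, h1, h2⟩ := h
  rw [sqrt_sq_add_zero ha.le] at h1 h2
  constructor
  · have : q.1 * a = 0 := by linarith
    exact (mul_eq_zero.1 this).resolve_right ha.ne'
  · have : (q.2 + 1) * a = 0 := by linarith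
    linarith [(mul_eq_zero.1 this).resolve_right ha.ne']

theorem IsFBGrad.of_zero_pos {b : ℝ} {q : ℝ × ℝ} (hb : 0 < b) (h : IsFBGrad 0 b q) :
    q.1 = -1 ∧ q.2 = 0 :=
  (h.swap.of_pos_zero hb).symm

/-- The sign information contained in a row `-q₁ g + q₂ m = 0` of the generalized Jacobian. -/
theorem IsFBGrad.mul_nonneg {a b g m : ℝ} {q : ℝ × ℝ} (h : IsFBGrad a b q)
    (hrow : q.1 * -g + q.2 * m = 0) : 0 ≤ m * g := by
  obtain ⟨h1, h2⟩ := h.nonpos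
  have h3 := h.1
  rcases h1.eq_or_lt with h0 | h0
  · have hq2 : q.2 < 0 := by
      refine lt_of_le_of_ne h2 fun h4 => ?_
      rw [h0, h4] at h3; norm_num at h3
    rw [h0, zero_mul, zero_add] at hrow
    rw [(mul_eq_zero.1 hrow).resolve_left hq2.ne, zero_mul]
  · -- `(-q₁) (m g) = (-q₂) m²`
    have h4 : -q.1 * (m * g) = -q.2 * m ^ 2 := by linear_combination m * hrow
    by_contra! hneg
    nlinarith [sq_nonneg m]

/-- Along differentiable curves through a point off the origin, the derivative of the
Fischer-Burmeister function is given by the generalized gradient. -/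
theorem exists_isFBGrad {a b : ℝ} (h : a ≠ 0 ∨ b ≠ 0) :
    ∃ q, IsFBGrad a b q ∧ ∀ (f g : ℝ → ℝ) (f' g' : ℝ), f 0 = a → g 0 = b → HasDerivAt f f' 0 →
      HasDerivAt g g' 0 → HasDerivAt (fun t => fischerBurmeister (f t) (g t))
        (q.1 * f' + q.2 * g') 0 := by
  have hpos : 0 < a ^ 2 + b ^ 2 := by
    rcases h with h | h <;> positivity
  have hr0 : 0 < √(a ^ 2 + b ^ 2) := Real.sqrt_pos.2 hpos
  have hr := Real.sq_sqrt hpos.le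
  set r := √(a ^ 2 + b ^ 2) with hrdef
  refine ⟨(a / r - 1, b / r - 1), ⟨?_, ?_, ?_⟩, fun f g f' g' hf hg hf' hg' => ?_⟩
  · have : (a / r) ^ 2 + (b / r) ^ 2 = 1 := by
      rw [div_pow, div_pow, ← add_div, hr, div_self hpos.ne']
    simpa using this.le
  · rw [← hrdef]; field_simp
  · rw [← hrdef]; field_simp
  · have hs := ((hf'.pow 2).add (hg'.pow 2)).sqrt (by simpa [hf, hg] using hpos.ne')
    refine ((hs.sub hf').sub hg').congr_deriv ?_
    simp only [Pi.add_apply, Pi.pow_apply, hf, hg, ← hrdef]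
    field_simp
    ring

/-- The Fischer-Burmeister function is not differentiable at the origin along the second axis. -/
theorem not_differentiableAt_fischerBurmeister :
    ¬ DifferentiableAt ℝ (fun t => fischerBurmeister 0 t) 0 := by
  intro h
  have : (fun t : ℝ => |t|) = fun t => fischerBurmeister 0 t + t := by
    funext t
    simp [fischerBurmeister, Real.sqrt_sq_eq_abs]
  have h2 : DifferentiableAt ℝ (fun t : ℝ => |t|) 0 := by
    rw [this]; exact h.add differentiableAt_id
  exact not_differentiableAt_abs_zero h2

end FischerBurmeister

/-! ### The model of the generalized Jacobian -/

section Parts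

variable {n k m : ℕ}

@[simp] theorem xPart_apply (Y : YSpace n k m) (i : Fin n) : xPart Y i = Y (Sum.inl i) := rfl
@[simp] theorem nuPart_apply (Y : YSpace n k m) (i : Fin n) :
    nuPart Y i = Y (Sum.inr (Sum.inl i)) := rfl
@[simp] theorem muPart_apply (Y : YSpace n k m) (i : Fin k) :
    muPart Y i = Y (Sum.inr (Sum.inr (Sum.inl i))) := rfl
@[simp] theorem lamPart_apply (Y : YSpace n k m) (j : Fin m) :
    lamPart Y j = Y (Sum.inr (Sum.inr (Sum.inr j))) := rfl

theorem xPart_add (Y v : YSpace n k m) : xPart (Y + v) = xPart Y + xPart v := rfl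
theorem xPart_smul (t : ℝ) (v : YSpace n k m) : xPart (t • v) = t • xPart v := rfl
theorem xPart_sub (Y v : YSpace n k m) : xPart (Y - v) = xPart Y - xPart v := rfl

@[fun_prop] theorem continuous_xPart : Continuous (xPart : YSpace n k m → _) :=
  (PiLp.continuous_toLp 2 _).comp (by fun_prop)

theorem norm_xPart_le (Y : YSpace n k m) : ‖xPart Y‖ ≤ ‖Y‖ := by
  rw [EuclideanSpace.norm_eq, EuclideanSpace.norm_eq, Fintype.sum_sum_type]
  exact Real.sqrt_le_sqrt (le_add_of_nonneg_right (by positivity))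

theorem abs_apply_le_norm {ι : Type*} [Fintype ι] (Y : EuclideanSpace ℝ ι) (r : ι) :
    |Y r| ≤ ‖Y‖ := PiLp.norm_apply_le Y r

theorem abs_mulVec_apply_le (Q : Matrix (Fin n) (Fin n) ℝ) (x : EuclideanSpace ℝ (Fin n))
    (i : Fin n) : |Q.mulVec x.ofLp i| ≤ ‖Matrix.toEuclideanCLM (n := Fin n) (𝕜 := ℝ) Q‖ * ‖x‖ := by
  have := abs_apply_le_norm (Matrix.toEuclideanCLM (n := Fin n) (𝕜 := ℝ) Q x) i
  rw [Matrix.ofLp_toEuclideanCLM] at this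
  exact this.trans (ContinuousLinearMap.le_opNorm _ _)

end Parts

/-- The exact second order expansion of a quadratic function. -/
theorem quad_add {n : ℕ} {Q : Matrix (Fin n) (Fin n) ℝ} (hQ : Q.IsSymm)
    (q : EuclideanSpace ℝ (Fin n)) (c : ℝ) (x d : EuclideanSpace ℝ (Fin n)) :
    quad Q q c (x + d) = quad Q q c x + inner ℝ (quadGrad Q q x) d +
      (1 / 2) * (d.ofLp ⬝ᵥ Q.mulVec d.ofLp) := by
  have hsym : d.ofLp ⬝ᵥ Q.mulVec x.ofLp = x.ofLp ⬝ᵥ Q.mulVec d.ofLp := by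
    rw [Matrix.dotProduct_mulVec, ← Matrix.mulVec_transpose, hQ.eq, dotProduct_comm]
  simp only [quad, quadGrad, EuclideanSpace.inner_eq_star_dotProduct, Matrix.ofLp_toEuclideanCLM,
    star_trivial, WithLp.ofLp_add, Matrix.mulVec_add, dotProduct_add, add_dotProduct, hsym,
    dotProduct_comm q.ofLp]
  ring

namespace Problem

variable {n k m : ℕ} (P : Problem n k m)

theorem f_add (i : Fin k) (x d : EuclideanSpace ℝ (Fin n)) :
    P.f i (x + d) = P.f i x + inner ℝ (P.gradf i x) d +
      (1 / 2) * (d.ofLp ⬝ᵥ (P.Q i).mulVec d.ofLp) :=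
  quad_add (P.symm i) _ _ _ _

theorem lin_add (j : Fin m) (x d : EuclideanSpace ℝ (Fin n)) :
    P.lin j (x + d) = P.lin j x + P.lin j d := dotProduct_add _ _ _

theorem lin_smul (j : Fin m) (t : ℝ) (d : EuclideanSpace ℝ (Fin n)) :
    P.lin j (t • d) = t * P.lin j d := dotProduct_smul _ _ _

theorem gradf_apply (j : Fin k) (x : EuclideanSpace ℝ (Fin n)) (i : Fin n) :
    P.gradf j x i = (P.Q j).mulVec x.ofLp i + P.q j i := by
  simp [gradf, quadGrad, Matrix.ofLp_toEuclideanCLM]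

theorem gradL_apply (x : EuclideanSpace ℝ (Fin n)) (μ : EuclideanSpace ℝ (Fin k))
    (l : EuclideanSpace ℝ (Fin m)) (i : Fin n) :
    P.gradL x μ l i = P.Q₀.mulVec x.ofLp i + P.q₀ i + ∑ j, μ j * P.gradf j x i
      + ∑ j, l j * P.A j i := by
  simp [gradL, quadGrad, Matrix.ofLp_toEuclideanCLM]

theorem hessL_mulVec_apply (μ : EuclideanSpace ℝ (Fin k)) (x : Fin n → ℝ) (i : Fin n) :
    (P.hessL μ).mulVec x i = P.Q₀.mulVec x i + ∑ j, μ j * (P.Q j).mulVec x i := by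
  simp [hessL, Matrix.add_mulVec, Matrix.sum_mulVec, Matrix.smul_mulVec]

/-- The derivative at `Y`, in the direction `v`, of the component `i` of `∇ₓL + ν`. -/
noncomputable def gradLDeriv (Y v : YSpace n k m) (i : Fin n) : ℝ :=
  (P.hessL (muPart Y)).mulVec (xPart v).ofLp i + nuPart v i
    + ∑ j, muPart v j * P.gradf j (xPart Y) i + ∑ j, lamPart v j * P.A j i

/-- The exact second order expansion of `∇ₓL + ν`, which is bilinear in `(x, μ)`. -/
theorem gradL_add (Y v : YSpace n k m) (i : Fin n) :
    P.gradL (xPart (Y + v)) (muPart (Y + v)) (lamPart (Y + v)) i + nuPart (Y + v) i =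
      P.gradL (xPart Y) (muPart Y) (lamPart Y) i + nuPart Y i + P.gradLDeriv Y v i
        + ∑ j, muPart v j * (P.Q j).mulVec (xPart v).ofLp i := by
  have h1 : ∀ j, muPart (Y + v) j * P.gradf j (xPart (Y + v)) i =
      muPart Y j * P.gradf j (xPart Y) i + muPart Y j * (P.Q j).mulVec (xPart v).ofLp i
      + muPart v j * P.gradf j (xPart Y) i + muPart v j * (P.Q j).mulVec (xPart v).ofLp i := by
    intro j
    simp only [gradf_apply, muPart_apply, PiLp.add_apply, xPart_add, WithLp.ofLp_add,
      Matrix.mulVec_add, Pi.add_apply]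
    ring
  have h2 : ∀ j, lamPart (Y + v) j * P.A j i = lamPart Y j * P.A j i + lamPart v j * P.A j i :=
    fun j => by simp only [lamPart_apply, PiLp.add_apply]; ring
  simp only [gradL_apply, gradLDeriv, hessL_mulVec_apply, h1, h2, Finset.sum_add_distrib]
  simp only [xPart_add, WithLp.ofLp_add, Matrix.mulVec_add, Pi.add_apply, nuPart_apply,
    PiLp.add_apply]
  ring

theorem gradLDeriv_smul (Y v : YSpace n k m) (t : ℝ) (i : Fin n) :
    P.gradLDeriv Y (t • v) i = t * P.gradLDeriv Y v i := by
  simp only [gradLDeriv, xPart_smul, WithLp.ofLp_smul, Matrix.mulVec_smul, Pi.smul_apply,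
    nuPart_apply, muPart_apply, lamPart_apply, PiLp.smul_apply, smul_eq_mul, mul_assoc,
    ← Finset.mul_sum]
  ring

end Problem

/-- Coefficients of an element of the generalized Jacobian: a generalized derivative of each
coordinate projection, and a generalized gradient of the Fischer-Burmeister function for each
quadratic and each linear constraint. -/
abbrev Coef (n k m : ℕ) : Type := (Fin n → ℝ) × (Fin k → ℝ × ℝ) × (Fin m → ℝ × ℝ)

namespace Problem

variable {n k m : ℕ} (P : Problem n k m)

/-- The linear map, applied to `v`, that the chain rule gives for the derivative of `F(·; T)` at `Y`
if the nonsmooth functions have the generalized derivatives `p`. -/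
noncomputable def modelJac (T : Finset (Fin n)) (Y : YSpace n k m) (p : Coef n k m)
    (v : YSpace n k m) : YSpace n k m :=
  WithLp.toLp 2
    (Sum.elim (fun i => if i ∈ T then P.gradLDeriv Y v i else xPart v i)
    (Sum.elim (fun i => if i ∈ T then xPart v i - p.1 i * (xPart v i + nuPart v i)
      else nuPart v i)
    (Sum.elim
      (fun i => (p.2.1 i).1 * -inner ℝ (P.gradf i (xPart Y)) (xPart v)
        + (p.2.1 i).2 * muPart v i)
      (fun j => (p.2.2 j).1 * -P.lin j (xPart v) + (p.2.2 j).2 * lamPart v j))))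

/-- The coefficients `p` are generalized derivatives at `Y`, a point near `Ys`. For the projections
only what holds near `Ys` is recorded: the derivative reproduces the increment from `Ys`, it
vanishes if the argument at `Ys` lies outside of the interval, and it is `1` if it lies in the
interior. Every condition is closed in `(Y, p)` and convex in `p`. -/
structure IsSelection (T : Finset (Fin n)) (Ys Y : YSpace n k m) (p : Coef n k m) : Prop where
  mem_Icc : ∀ i, p.1 i ∈ Set.Icc (0 : ℝ) 1
  secant : ∀ i ∈ T, p.1 i * ((xPart Y i + nuPart Y i) - (xPart Ys i + nuPart Ys i)) =
    proj (P.X i) (xPart Y i + nuPart Y i) - proj (P.X i) (xPart Ys i + nuPart Ys i)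
  outside : ∀ i ∈ T, xPart Ys i + nuPart Ys i ∉ P.X i → p.1 i = 0
  inside : ∀ i ∈ T, xPart Ys i + nuPart Ys i ∈ interior (P.X i) → p.1 i = 1
  quad : ∀ i, IsFBGrad (-(P.f i (xPart Y))) (muPart Y i) (p.2.1 i)
  linear : ∀ j, IsFBGrad (P.b j - P.lin j (xPart Y)) (lamPart Y j) (p.2.2 j)

variable {P} {T : Finset (Fin n)} {Ys Y : YSpace n k m}

theorem IsSelection.mem_closedBall {p : Coef n k m} (h : P.IsSelection T Ys Y p) :
    p ∈ Metric.closedBall (0 : Coef n k m) 2 := by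
  rw [mem_closedBall_zero_iff, norm_prod_le_iff, norm_prod_le_iff]
  refine ⟨(pi_norm_le_iff_of_nonneg zero_le_two).2 fun i => ?_,
    (pi_norm_le_iff_of_nonneg zero_le_two).2 fun i => ?_,
    (pi_norm_le_iff_of_nonneg zero_le_two).2 fun j => ?_⟩
  · rw [Real.norm_eq_abs, abs_of_nonneg (h.mem_Icc i).1]
    linarith [(h.mem_Icc i).2]
  · exact norm_prod_le_iff.2 (h.quad i).abs_le
  · exact norm_prod_le_iff.2 (h.linear j).abs_le

theorem IsSelection.convex {p p' : Coef n k m} (h : P.IsSelection T Ys Y p)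
    (h' : P.IsSelection T Ys Y p') {s t : ℝ} (hs : 0 ≤ s) (ht : 0 ≤ t) (hst : s + t = 1) :
    P.IsSelection T Ys Y (s • p + t • p') where
  mem_Icc i := convex_Icc (0 : ℝ) 1 (h.mem_Icc i) (h'.mem_Icc i) hs ht hst
  secant i hi := by
    simp only [Prod.fst_add, Prod.smul_fst, Pi.add_apply, Pi.smul_apply, smul_eq_mul]
    have ht' : t = 1 - s := by linarith
    subst ht'
    linear_combination s * h.secant i hi + (1 - s) * h'.secant i hi
  outside i hi ho := by
    simp [h.outside i hi ho, h'.outside i hi ho]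
  inside i hi ho := by
    simp [h.inside i hi ho, h'.inside i hi ho, hst]
  quad i := (h.quad i).convex (h'.quad i) hs ht hst
  linear j := (h.linear j).convex (h'.linear j) hs ht hst

theorem modelJac_convex (v : YSpace n k m) (p p' : Coef n k m) {s t : ℝ} (hst : s + t = 1) :
    P.modelJac T Y (s • p + t • p') v = s • P.modelJac T Y p v + t • P.modelJac T Y p' v := by
  have ht' : t = 1 - s := by linarith
  subst ht'
  ext r
  rcases r with i | i | i | j <;>
    simp only [modelJac, PiLp.add_apply, PiLp.smul_apply, Sum.elim_inl, Sum.elim_inr, smul_eq_mul,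
      Prod.fst_add, Prod.snd_add, Prod.smul_fst, Prod.smul_snd, Pi.add_apply, Pi.smul_apply]
  · split_ifs <;> ring
  · split_ifs <;> ring
  · ring
  · ring

variable (P T Ys)

theorem continuous_proj (i : Fin n) : Continuous (proj (P.X i)) :=
  (proj_lipschitz (P.X_closed i) (P.X_interval i) ⟨0, P.zero_mem_X i⟩).continuous

@[fun_prop] theorem continuous_gradf (i : Fin k) : Continuous (P.gradf i) := by
  unfold gradf quadGrad; fun_prop

@[fun_prop] theorem continuous_f (i : Fin k) : Continuous (P.f i) := by
  unfold f SNSQP.quad; fun_prop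

@[fun_prop] theorem continuous_lin (j : Fin m) : Continuous (P.lin j) := by
  unfold lin; fun_prop

@[fun_prop] theorem continuous_modelJac {Z : Type*} [TopologicalSpace Z]
    {Y v : Z → YSpace n k m} {p : Z → Coef n k m} (hY : Continuous Y) (hp : Continuous p)
    (hv : Continuous v) : Continuous fun z => P.modelJac T (Y z) (p z) (v z) := by
  refine (PiLp.continuous_toLp 2 _).comp (continuous_pi fun r => ?_)
  rcases r with i | i | i | j <;> simp only [Sum.elim_inl, Sum.elim_inr]
  · split_ifs
    · simp only [gradLDeriv, hessL_mulVec_apply]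
      simp only [Matrix.mulVec, dotProduct, xPart_apply, nuPart_apply, muPart_apply, lamPart_apply]
      fun_prop
    · simp only [xPart_apply]; fun_prop
  · simp only [xPart_apply, nuPart_apply]
    split_ifs <;> fun_prop
  · simp only [muPart_apply]; fun_prop
  · simp only [lamPart_apply]; fun_prop

theorem isClosed_isFBGrad {Z : Type*} [TopologicalSpace Z] {a b : Z → ℝ} {q : Z → ℝ × ℝ}
    (ha : Continuous a) (hb : Continuous b) (hq : Continuous q) :
    IsClosed {z | IsFBGrad (a z) (b z) (q z)} := by
  simp only [IsFBGrad, Set.ofPred_and]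
  exact (isClosed_le (by fun_prop) (by fun_prop)).inter
    ((isClosed_eq (by fun_prop) (by fun_prop)).inter (isClosed_eq (by fun_prop) (by fun_prop)))

theorem isClosed_isSelection :
    IsClosed {z : YSpace n k m × Coef n k m | P.IsSelection T Ys z.1 z.2} := by
  have hset : {z : YSpace n k m × Coef n k m | P.IsSelection T Ys z.1 z.2} =
      {z | ∀ i, z.2.1 i ∈ Set.Icc (0 : ℝ) 1} ∩
      ({z | ∀ i ∈ T, z.2.1 i * ((xPart z.1 i + nuPart z.1 i) - (xPart Ys i + nuPart Ys i)) =
        proj (P.X i) (xPart z.1 i + nuPart z.1 i) - proj (P.X i) (xPart Ys i + nuPart Ys i)} ∩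
      ({z | ∀ i ∈ T, xPart Ys i + nuPart Ys i ∉ P.X i → z.2.1 i = 0} ∩
      ({z | ∀ i ∈ T, xPart Ys i + nuPart Ys i ∈ interior (P.X i) → z.2.1 i = 1} ∩
      ({z | ∀ i, IsFBGrad (-(P.f i (xPart z.1))) (muPart z.1 i) (z.2.2.1 i)} ∩
      {z | ∀ j, IsFBGrad (P.b j - P.lin j (xPart z.1)) (lamPart z.1 j) (z.2.2.2 j)})))) := by
    ext z
    exact ⟨fun ⟨h1, h2, h3, h4, h5, h6⟩ => ⟨h1, h2, h3, h4, h5, h6⟩,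
      fun ⟨h1, h2, h3, h4, h5, h6⟩ => ⟨h1, h2, h3, h4, h5, h6⟩⟩
  rw [hset]
  simp only [Set.ofPred_forall]
  refine .inter (isClosed_iInter fun i => ?_) (.inter (isClosed_biInter fun i _ => ?_)
    (.inter (isClosed_biInter fun i _ => isClosed_iInter fun _ => ?_)
    (.inter (isClosed_biInter fun i _ => isClosed_iInter fun _ => ?_)
    (.inter (isClosed_iInter fun i => ?_) (isClosed_iInter fun j => ?_)))))
  · exact isClosed_Icc.preimage (by fun_prop)
  · have := P.continuous_proj i
    simp only [xPart_apply, nuPart_apply]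
    exact isClosed_eq (by fun_prop) (by fun_prop)
  · exact isClosed_eq (by fun_prop) (by fun_prop)
  · exact isClosed_eq (by fun_prop) (by fun_prop)
  · simp only [muPart_apply]
    exact isClosed_isFBGrad (by fun_prop) (by fun_prop) (by fun_prop)
  · simp only [lamPart_apply]
    exact isClosed_isFBGrad (by fun_prop) (by fun_prop) (by fun_prop)

/-- If near `Ys` the derivatives are of the model form, so are the elements of the Clarke
generalized Jacobian, since the model is closed and convex. -/
theorem clarkeJacobian_subset_model
    (h : ∀ᶠ Y in 𝓝 Ys, DifferentiableAt ℝ (P.F T) Y → ∃ p, P.IsSelection T Ys Y p ∧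
      ∀ v, fderiv ℝ (P.F T) Y v = P.modelJac T Y p v) :
    ∀ᶠ Y in 𝓝 Ys, ∀ A ∈ clarkeJacobian (P.F T) Y, ∃ p, P.IsSelection T Ys Y p ∧
      ∀ v, A v = P.modelJac T Y p v := by
  filter_upwards [h.eventually_nhds] with Y hY A hA
  refine convexHull_min (t := {A : YSpace n k m →L[ℝ] YSpace n k m |
    ∃ p, P.IsSelection T Ys Y p ∧ ∀ v, A v = P.modelJac T Y p v}) ?_ ?_ hA
  · rintro B ⟨u, hdiff, hu, hB⟩
    obtain ⟨N, hN⟩ := eventually_atTop.1 (hu.eventually hY)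
    choose p hp hpv using fun j : ℕ => hN (j + N) (Nat.le_add_left _ _) (hdiff _)
    obtain ⟨p₀, -, φ, hφ, hlim⟩ := (isCompact_closedBall (0 : Coef n k m) 2).tendsto_subseq
      fun j => (hp j).mem_closedBall
    have hsub : Tendsto (fun j => φ j + N) atTop atTop :=
      (tendsto_add_atTop_nat N).comp hφ.tendsto_atTop
    have hu' := hu.comp hsub
    refine ⟨p₀, (P.isClosed_isSelection T Ys).mem_of_tendsto (hu'.prodMk_nhds hlim)
      (.of_forall fun j => hp (φ j)), fun v => ?_⟩
    have h1 : Tendsto (fun j => fderiv ℝ (P.F T) (u (φ j + N)) v) atTop (𝓝 (B v)) :=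
      ((ContinuousLinearMap.apply ℝ _ v).continuous.tendsto B).comp (hB.comp hsub)
    have h2 := ((P.continuous_modelJac T (Z := YSpace n k m × Coef n k m × YSpace n k m)
      continuous_fst continuous_snd.fst continuous_snd.snd).tendsto (Y, p₀, v)).comp
      (hu'.prodMk_nhds (hlim.prodMk_nhds (tendsto_const_nhds (x := v))))
    refine tendsto_nhds_unique h1 (h2.congr fun j => (hpv (φ j) v).symm)
  · rintro B ⟨p, hp, hB⟩ B' ⟨p', hp', hB'⟩ s t hs ht hst
    refine ⟨s • p + t • p', hp.convex hp' hs ht hst, fun v => ?_⟩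
    rw [modelJac_convex v p p' hst, ← hB, ← hB']
    rfl

end Problem

/-! ### Differentiability and Lipschitz continuity of the stationary equations -/

theorem hasDerivAt_quadratic (a b c : ℝ) :
    HasDerivAt (fun t : ℝ => a + t * b + t ^ 2 * c) b 0 := by
  have h := (((hasDerivAt_id (0 : ℝ)).mul_const b).const_add a).add
    ((hasDerivAt_pow 2 (0 : ℝ)).mul_const c)
  exact h.congr_deriv (by simp)

theorem norm_le_sum_abs {ι : Type*} [Fintype ι] (y : EuclideanSpace ℝ ι) : ‖y‖ ≤ ∑ r, |y r| := by
  classical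
  calc ‖y‖ = ‖∑ r, EuclideanSpace.single r (y r)‖ := by
        congr 1
        ext r
        simp [Finset.sum_apply, Pi.single_apply]
    _ ≤ ∑ r, ‖EuclideanSpace.single r (y r)‖ := norm_sum_le _ _
    _ = ∑ r, |y r| := by simp

theorem locallyLipschitz_euclidean {E ι : Type*} [SeminormedAddCommGroup E] [Fintype ι]
    {g : E → EuclideanSpace ℝ ι} (h : ∀ r, LocallyLipschitz fun y => g y r) :
    LocallyLipschitz g := by
  intro y
  choose K t ht hK using fun r => h r y
  refine ⟨∑ r, K r, ⋂ r, t r, iInter_mem.2 ht, LipschitzOnWith.of_dist_le_mul fun a ha b hb => ?_⟩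
  rw [Set.mem_iInter] at ha hb
  rw [dist_eq_norm, NNReal.coe_sum, Finset.sum_mul]
  exact (norm_le_sum_abs _).trans
    (Finset.sum_le_sum fun r _ => (hK r).dist_le_mul a (ha r) b (hb r))

theorem locallyLipschitz_fischerBurmeister :
    LocallyLipschitz fun z : ℝ × ℝ => fischerBurmeister z.1 z.2 := by
  have hn : LocallyLipschitz fun z : ℝ × ℝ => √(z.1 ^ 2 + z.2 ^ 2) := by
    have : (fun z : ℝ × ℝ => √(z.1 ^ 2 + z.2 ^ 2)) =
        norm ∘ fun z => Complex.equivRealProdCLM.symm z := by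
      funext z
      simp [Complex.norm_def, Complex.normSq_apply, sq, Complex.equivRealProdCLM_symm_apply]
    rw [this]
    exact lipschitzWith_one_norm.locallyLipschitz.comp
      (Complex.equivRealProdCLM.symm.contDiff (n := 1)).locallyLipschitz
  have h1 : LocallyLipschitz fun z : ℝ × ℝ => z.1 := LipschitzWith.prod_fst.locallyLipschitz
  have h2 : LocallyLipschitz fun z : ℝ × ℝ => z.2 := LipschitzWith.prod_snd.locallyLipschitz
  exact (hn.sub h1).sub h2

theorem LocallyLipschitz.fischerBurmeister {E : Type*} [PseudoEMetricSpace E] {a b : E → ℝ}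
    (ha : LocallyLipschitz a) (hb : LocallyLipschitz b) :
    LocallyLipschitz fun y => fischerBurmeister (a y) (b y) := by
  have h1 := ha.prodMk hb
  exact LocallyLipschitz.comp (f := fun z : ℝ × ℝ => SNSQP.fischerBurmeister z.1 z.2)
    (g := fun y => (a y, b y)) locallyLipschitz_fischerBurmeister h1

/-- By Rademacher's theorem the Clarke generalized Jacobian of a locally Lipschitz map between
finite-dimensional spaces is nonempty. -/
theorem clarkeJacobian_nonempty {E F : Type*} [NormedAddCommGroup E] [NormedSpace ℝ E]
    [FiniteDimensional ℝ E] [NormedAddCommGroup F] [NormedSpace ℝ F] [FiniteDimensional ℝ F]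
    {f : E → F} (hf : LocallyLipschitz f) (x : E) : (clarkeJacobian f x).Nonempty := by
  let _ : MeasurableSpace E := borel E
  have : BorelSpace E := ⟨rfl⟩
  obtain ⟨K, t, ht, hK⟩ := hf x
  obtain ⟨ε, hε, hball⟩ := Metric.mem_nhds_iff.1 ht
  have hK' := hK.mono hball
  have hdense := MeasureTheory.Measure.dense_of_ae
    (hK'.ae_differentiableWithinAt_of_mem (μ := MeasureTheory.Measure.addHaar))
  have hex : ∀ j : ℕ, ∃ u ∈ Metric.ball x ε, dist u x < 1 / ((j : ℝ) + 1) ∧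
      DifferentiableAt ℝ f u := by
    intro j
    have hj : (0 : ℝ) < 1 / ((j : ℝ) + 1) := by positivity
    obtain ⟨u, hu, hd⟩ := hdense.inter_open_nonempty _ (Metric.isOpen_ball (x := x)
      (ε := min ε (1 / ((j : ℝ) + 1)))) ⟨x, Metric.mem_ball_self (lt_min hε hj)⟩
    have hu' := lt_min_iff.1 (Metric.mem_ball.1 hu)
    exact ⟨u, hu'.1, hu'.2, (hd hu'.1).differentiableAt (Metric.isOpen_ball.mem_nhds hu'.1)⟩
  choose u hu hdist hdiff using hex
  have hlim : Tendsto u atTop (𝓝 x) :=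
    tendsto_iff_dist_tendsto_zero.2 (squeeze_zero (fun _ => dist_nonneg) (fun j => (hdist j).le)
      tendsto_one_div_add_atTop_nhds_zero_nat)
  have hbound : ∀ j, fderiv ℝ f (u j) ∈ Metric.closedBall (0 : E →L[ℝ] F) K := fun j => by
    rw [mem_closedBall_zero_iff]
    exact norm_fderiv_le_of_lipschitzOn ℝ (Metric.isOpen_ball.mem_nhds (hu j)) hK'
  have : ProperSpace (E →L[ℝ] F) := FiniteDimensional.proper ℝ _
  obtain ⟨A, -, φ, hφ, hA⟩ := (isCompact_closedBall (0 : E →L[ℝ] F) K).tendsto_subseq hbound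
  exact ⟨A, subset_convexHull ℝ _ ⟨u ∘ φ, fun j => hdiff _, hlim.comp hφ.tendsto_atTop, hA⟩⟩

namespace Problem

variable {n k m : ℕ} (P : Problem n k m) (T : Finset (Fin n))

theorem contDiff_f_xPart (i : Fin k) :
    ContDiff ℝ 1 fun Y : YSpace n k m => P.f i (xPart Y) := by
  simp only [f, SNSQP.quad, Matrix.mulVec, dotProduct, xPart_apply]
  fun_prop

theorem contDiff_lin_xPart (j : Fin m) :
    ContDiff ℝ 1 fun Y : YSpace n k m => P.lin j (xPart Y) := by
  simp only [lin, dotProduct, xPart_apply]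
  fun_prop

theorem locallyLipschitz_F : LocallyLipschitz (P.F T) := by
  have hcoord : ∀ r, ContDiff ℝ 1 fun Y : YSpace n k m => Y r := fun r => by fun_prop
  have hgrad : ∀ i, ContDiff ℝ 1 fun Y : YSpace n k m =>
      P.gradL (xPart Y) (muPart Y) (lamPart Y) i + nuPart Y i := by
    intro i
    simp only [gradL_apply, gradf_apply, Matrix.mulVec, dotProduct, xPart_apply, nuPart_apply,
      muPart_apply, lamPart_apply]
    fun_prop
  have hproj : ∀ i, LocallyLipschitz fun Y : YSpace n k m =>
      xPart Y i - proj (P.X i) (xPart Y i + nuPart Y i) := by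
    intro i
    have h1 : LocallyLipschitz fun Y : YSpace n k m => Y (Sum.inl i) + Y (Sum.inr (Sum.inl i)) :=
      ((hcoord _).add (hcoord _)).locallyLipschitz
    have h2 : LocallyLipschitz (proj (P.X i)) :=
      (proj_lipschitz (P.X_closed i) (P.X_interval i) ⟨0, P.zero_mem_X i⟩).locallyLipschitz
    have h3 : LocallyLipschitz fun Y : YSpace n k m => Y (Sum.inl i) := (hcoord _).locallyLipschitz
    have h4 : LocallyLipschitz fun Y : YSpace n k m =>
      proj (P.X i) (Y (Sum.inl i) + Y (Sum.inr (Sum.inl i))) := h2.comp h1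
    exact h3.sub h4
  refine locallyLipschitz_euclidean fun r => ?_
  rcases r with i | i | i | j
  · by_cases hi : i ∈ T
    · simpa [F, hi] using (hgrad i).locallyLipschitz
    · simpa [F, hi] using (hcoord (Sum.inl i)).locallyLipschitz
  · by_cases hi : i ∈ T
    · simpa [F, hi] using hproj i
    · simpa [F, hi] using (hcoord (Sum.inr (Sum.inl i))).locallyLipschitz
  · exact LocallyLipschitz.fischerBurmeister (P.contDiff_f_xPart i).neg.locallyLipschitz
      (hcoord (Sum.inr (Sum.inr (Sum.inl i)))).locallyLipschitz
  · exact LocallyLipschitz.fischerBurmeister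
      (contDiff_const.sub (P.contDiff_lin_xPart j)).locallyLipschitz
      (hcoord (Sum.inr (Sum.inr (Sum.inr j)))).locallyLipschitz

theorem genJac_nonempty (Y : YSpace n k m) : (P.genJac T Y).Nonempty := by
  obtain ⟨A, hA⟩ := clarkeJacobian_nonempty (P.locallyLipschitz_F T) Y
  obtain ⟨W, rfl⟩ := (Matrix.toEuclideanCLM (n := Idx n k m) (𝕜 := ℝ)).surjective A
  exact ⟨W, hA⟩

/-- Near `Ys` the derivative of `F(·; T)`, where it exists, is of the model form. -/
theorem fderiv_F_eq_modelJac (Ys : YSpace n k m) :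
    ∀ᶠ Y in 𝓝 Ys, DifferentiableAt ℝ (P.F T) Y → ∃ p, P.IsSelection T Ys Y p ∧
      ∀ v, fderiv ℝ (P.F T) Y v = P.modelJac T Y p v := by
  have hnear : ∀ᶠ Y in 𝓝 Ys, ∀ i, ∀ δ,
      HasDerivAt (proj (P.X i)) δ (xPart Y i + nuPart Y i) →
      δ * ((xPart Y i + nuPart Y i) - (xPart Ys i + nuPart Ys i)) =
        proj (P.X i) (xPart Y i + nuPart Y i) - proj (P.X i) (xPart Ys i + nuPart Ys i) ∧
      (xPart Ys i + nuPart Ys i ∉ P.X i → δ = 0) ∧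
      (xPart Ys i + nuPart Ys i ∈ interior (P.X i) → δ = 1) := by
    refine eventually_all.2 fun i => ?_
    have hcont : Continuous fun Y : YSpace n k m => xPart Y i + nuPart Y i := by
      simp only [xPart_apply, nuPart_apply]; fun_prop
    exact (hcont.tendsto Ys).eventually
      (deriv_proj_near (P.X_closed i) (P.X_interval i) ⟨0, P.zero_mem_X i⟩ _)
  filter_upwards [hnear] with Y hY hdiff
  have hline : ∀ v r, HasDerivAt (fun t : ℝ => P.F T (Y + t • v) r) (fderiv ℝ (P.F T) Y v r) 0 := by
    intro v r
    have h1 : HasDerivAt (fun t : ℝ => Y + t • v) v 0 := by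
      simpa using ((hasDerivAt_id (0 : ℝ)).smul_const v).const_add Y
    have h2 : HasFDerivAt (P.F T) (fderiv ℝ (P.F T) Y) (Y + (0 : ℝ) • v) := by
      simpa using hdiff.hasFDerivAt
    exact ((EuclideanSpace.proj (𝕜 := ℝ) r).hasFDerivAt).comp_hasDerivAt (0 : ℝ)
      (h2.comp_hasDerivAt (0 : ℝ) h1)
  -- varying `ν_i` alone shows that the projections of the coordinates in `T` are differentiable
  have hproj : ∀ i, ∃ δ, i ∈ T → HasDerivAt (proj (P.X i)) δ (xPart Y i + nuPart Y i) := by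
    intro i
    by_cases hi : i ∈ T
    swap
    · exact ⟨0, fun h => absurd h hi⟩
    have h := hline (EuclideanSpace.single (Sum.inr (Sum.inl i)) 1) (Sum.inr (Sum.inl i))
    have hfun : (fun t : ℝ => P.F T (Y + t • EuclideanSpace.single (Sum.inr (Sum.inl i)) 1)
        (Sum.inr (Sum.inl i))) =
        fun t => xPart Y i - proj (P.X i) (xPart Y i + nuPart Y i + t) := by
      funext t
      simp [F, hi, add_assoc]
    rw [hfun] at h
    have h2 := h.const_sub (xPart Y i)
    simp only [sub_sub_cancel] at h2
    have h3 : HasDerivAt (fun z => z - (xPart Y i + nuPart Y i)) 1 (xPart Y i + nuPart Y i) :=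
      (hasDerivAt_id _).sub_const _
    have h4 := HasDerivAt.comp (xPart Y i + nuPart Y i) (h₂ := fun t =>
      proj (P.X i) (xPart Y i + nuPart Y i + t)) (by simpa using h2) h3
    have h5 : (fun t => proj (P.X i) (xPart Y i + nuPart Y i + t)) ∘
        (fun z => z - (xPart Y i + nuPart Y i)) = proj (P.X i) := by
      funext z; simp
    exact ⟨_, fun _ => h5 ▸ h4⟩
  choose δ hδ using hproj
  -- the arguments of the Fischer-Burmeister functions are not at the origin: there `F` fails to be
  -- differentiable in the direction of the multiplier
  have hquad : ∀ i, -(P.f i (xPart Y)) ≠ 0 ∨ muPart Y i ≠ 0 := by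
    intro i
    by_contra! h0
    have h := hline (EuclideanSpace.single (Sum.inr (Sum.inr (Sum.inl i))) 1)
      (Sum.inr (Sum.inr (Sum.inl i)))
    have hfun : (fun t : ℝ => P.F T (Y + t • EuclideanSpace.single
        (Sum.inr (Sum.inr (Sum.inl i))) 1) (Sum.inr (Sum.inr (Sum.inl i)))) =
        fun t => fischerBurmeister 0 t := by
      funext t
      have hx : xPart (Y + t • EuclideanSpace.single (Sum.inr (Sum.inr (Sum.inl i))) 1) =
          xPart Y := by ext; simp
      have hμ := h0.2
      rw [muPart_apply] at hμ
      simp [F, hx, h0.1, hμ]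
    exact not_differentiableAt_fischerBurmeister (hfun ▸ h).differentiableAt
  have hlin : ∀ j, P.b j - P.lin j (xPart Y) ≠ 0 ∨ lamPart Y j ≠ 0 := by
    intro j
    by_contra! h0
    have h := hline (EuclideanSpace.single (Sum.inr (Sum.inr (Sum.inr j))) 1)
      (Sum.inr (Sum.inr (Sum.inr j)))
    have hfun : (fun t : ℝ => P.F T (Y + t • EuclideanSpace.single
        (Sum.inr (Sum.inr (Sum.inr j))) 1) (Sum.inr (Sum.inr (Sum.inr j)))) =
        fun t => fischerBurmeister 0 t := by
      funext t
      have hx : xPart (Y + t • EuclideanSpace.single (Sum.inr (Sum.inr (Sum.inr j))) 1) =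
          xPart Y := by ext; simp
      have hl := h0.2
      rw [lamPart_apply] at hl
      simp [F, hx, h0.1, hl]
    exact not_differentiableAt_fischerBurmeister (hfun ▸ h).differentiableAt
  choose q hq hq' using fun i => exists_isFBGrad (hquad i)
  choose q₁ hq₁ hq₁' using fun j => exists_isFBGrad (hlin j)
  have hx : ∀ (v : YSpace n k m) (t : ℝ), xPart (Y + t • v) = xPart Y + t • xPart v :=
    fun _ _ => rfl
  have hcoord : ∀ (v : YSpace n k m) (r), HasDerivAt (fun t : ℝ => (Y + t • v) r) (v r) 0 := by
    intro v r
    simpa using hasDerivAt_quadratic (Y r) (v r) 0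
  -- the coefficients with `i ∉ T` do not enter the model; they only have to lie in `[0, 1]`
  refine ⟨(fun i => if i ∈ T then δ i else 0, q, q₁), ⟨fun i => ?_, fun i hi => ?_, fun i hi => ?_,
    fun i hi => ?_, hq, hq₁⟩, fun v => ?_⟩
  · dsimp only
    split_ifs with hi
    · exact deriv_proj_mem_Icc (P.X_closed i) (P.X_interval i) ⟨0, P.zero_mem_X i⟩ (hδ i hi)
    · simp
  · simpa [hi] using (hY i _ (hδ i hi)).1
  · simpa [hi] using (hY i _ (hδ i hi)).2.1
  · simpa [hi] using (hY i _ (hδ i hi)).2.2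
  · ext r
    refine (hline v r).unique ?_
    rcases r with i | i | i | j <;> simp only [F, modelJac, Sum.elim_inl, Sum.elim_inr]
    · split_ifs with hi
      · have hfun : (fun t : ℝ => P.gradL (xPart (Y + t • v)) (muPart (Y + t • v))
            (lamPart (Y + t • v)) i + nuPart (Y + t • v) i) = fun t =>
            P.gradL (xPart Y) (muPart Y) (lamPart Y) i + nuPart Y i + t * P.gradLDeriv Y v i
            + t ^ 2 * ∑ j, muPart v j * (P.Q j).mulVec (xPart v).ofLp i := by
          funext t
          rw [gradL_add, gradLDeriv_smul, Finset.mul_sum]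
          congr 1
          refine Finset.sum_congr rfl fun j _ => ?_
          simp only [muPart_apply, PiLp.smul_apply, xPart_smul, WithLp.ofLp_smul,
            Matrix.mulVec_smul, Pi.smul_apply, smul_eq_mul]
          ring
        rw [hfun]
        exact hasDerivAt_quadratic _ _ _
      · exact hcoord v _
    · split_ifs with hi
      · have h1 : HasDerivAt (fun t : ℝ => xPart (Y + t • v) i + nuPart (Y + t • v) i)
            (xPart v i + nuPart v i) 0 := (hcoord v _).add (hcoord v _)
        exact (hcoord v _).sub (HasDerivAt.comp (0 : ℝ) (h₂ := proj (P.X i))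
          (by simpa using hδ i hi) h1)
      · exact hcoord v _
    · refine hq' i _ _ _ _ (by simp) (by simp) (HasDerivAt.fun_neg ?_) (hcoord v _)
      have hfun : (fun t : ℝ => P.f i (xPart (Y + t • v))) = fun t => P.f i (xPart Y) +
          t * inner ℝ (P.gradf i (xPart Y)) (xPart v) +
          t ^ 2 * ((1 / 2) * ((xPart v).ofLp ⬝ᵥ (P.Q i).mulVec (xPart v).ofLp)) := by
        funext t
        rw [hx, f_add, inner_smul_right]
        simp only [WithLp.ofLp_smul, Matrix.mulVec_smul, smul_dotProduct, dotProduct_smul,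
          smul_eq_mul]
        ring
      rw [hfun]
      exact hasDerivAt_quadratic _ _ _
    · refine hq₁' j _ _ _ _ (by simp) (by simp) ?_ (hcoord v _)
      have hfun : (fun t : ℝ => P.b j - P.lin j (xPart (Y + t • v))) = fun t =>
          P.b j - P.lin j (xPart Y) + t * -P.lin j (xPart v) + t ^ 2 * 0 := by
        funext t
        rw [hx, lin_add, lin_smul]
        ring
      rw [hfun]
      exact hasDerivAt_quadratic _ _ _

end Problem

/-! ### Consequences of P-stationarity -/

theorem mem_supp {n : ℕ} {x : EuclideanSpace ℝ (Fin n)} {i : Fin n} : i ∈ supp x ↔ x i ≠ 0 := by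
  simp [supp]

theorem norm_sub_sq_sub {n : ℕ} (x z u : EuclideanSpace ℝ (Fin n)) :
    ‖x - u‖ ^ 2 - ‖z - u‖ ^ 2 = ∑ r, ((x r - u r) ^ 2 - (z r - u r) ^ 2) := by
  simp [EuclideanSpace.norm_sq_eq, Finset.sum_sub_distrib]

theorem sum_subtype_eq_sum {ι : Type*} [Fintype ι] {p : ι → Prop} [Fintype {i // p i}] {g : ι → ℝ}
    (h : ∀ i, ¬ p i → g i = 0) : ∑ i : {i // p i}, g i = ∑ i, g i := by
  classical
  rw [← Finset.sum_subtype (Finset.univ.filter p) (by simp) g]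
  exact Finset.sum_filter_of_ne fun i _ hi => by_contra fun hp => hi (h i hp)

namespace Problem

variable {n k m : ℕ} {P : Problem n k m} {τ : ℝ} {Ys : YSpace n k m}

theorem continuous_uVec_apply (P : Problem n k m) (τ : ℝ) (i : Fin n) :
    Continuous fun Y : YSpace n k m => P.uVec τ Y i := by
  simp only [uVec, PiLp.sub_apply, PiLp.smul_apply, PiLp.add_apply, smul_eq_mul, gradL_apply,
    Matrix.mulVec, dotProduct, xPart_apply, nuPart_apply, muPart_apply, lamPart_apply]
  fun_prop

namespace IsPStationary


theorem mem_projSet (h : P.IsPStationary τ Ys) :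
    xPart Ys ∈ projSet P.sparse (P.uVec τ Ys) := by
  have := h.sparse_proj
  rw [uVec, this]; rfl

theorem card_supp_le (h : P.IsPStationary τ Ys) : (supp (xPart Ys)).card ≤ P.s :=
  h.mem_projSet.1

/-- Any other sparse vector is farther away from `u` than `x`. -/
theorem norm_lt (h : P.IsPStationary τ Ys) {z : EuclideanSpace ℝ (Fin n)} (hz : z ∈ P.sparse)
    (hne : z ≠ xPart Ys) : ‖xPart Ys - P.uVec τ Ys‖ < ‖z - P.uVec τ Ys‖ := by
  by_contra! hle
  have hz' : z ∈ projSet P.sparse (P.uVec τ Ys) :=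
    ⟨hz, fun w hw => hle.trans (h.mem_projSet.2 w hw)⟩
  have hp := h.sparse_proj
  rw [← uVec] at hp
  rw [hp] at hz'
  exact hne hz'

/-- A coordinate that may be changed freely within the sparse set agrees with that of `u`. -/
theorem uVec_apply (h : P.IsPStationary τ Ys) {i : Fin n}
    (hi : i ∈ supp (xPart Ys) ∨ (supp (xPart Ys)).card < P.s) :
    P.uVec τ Ys i = xPart Ys i := by
  by_contra hne
  set x := xPart Ys
  set u := P.uVec τ Ys
  -- moving `x i` to `u i` stays in the sparse set and does not increase the distance to `u`
  let z : EuclideanSpace ℝ (Fin n) := WithLp.toLp 2 (Function.update x.ofLp i (u i))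
  have hsub : supp z ⊆ insert i (supp x) := by
    intro r hr
    by_cases hri : r = i
    · simp [hri]
    · simpa [mem_supp, z, hri] using hr
  have hz : z ∈ P.sparse := by
    have h1 := Finset.card_le_card hsub
    rcases hi with hi | hi
    · rw [Finset.insert_eq_of_mem hi] at h1
      exact h1.trans h.card_supp_le
    · exact h1.trans ((Finset.card_insert_le _ _).trans hi)
  have hzx : z ≠ x := fun h0 => hne (by simpa [z] using congrArg (fun y => y.ofLp i) h0)
  have hlt := pow_lt_pow_left₀ (h.norm_lt hz hzx) (norm_nonneg _) two_ne_zero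
  have hsum := norm_sub_sq_sub x z u
  have hnn : 0 ≤ ∑ r, ((x r - u r) ^ 2 - (z r - u r) ^ 2) := by
    refine Finset.sum_nonneg fun r _ => ?_
    by_cases hri : r = i
    · subst hri
      simp [z, sq_nonneg]
    · simp [z, hri]
  linarith

/-- On the support the entries of `u` are larger in absolute value than outside of it. -/
theorem uVec_lt (h : P.IsPStationary τ Ys) {i j : Fin n} (hi : i ∈ supp (xPart Ys))
    (hj : j ∉ supp (xPart Ys)) : |P.uVec τ Ys j| < |P.uVec τ Ys i| := by
  have hui := h.uVec_apply (.inl hi)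
  set x := xPart Ys
  set u := P.uVec τ Ys
  have hij : i ≠ j := fun h0 => hj (h0 ▸ hi)
  have hxj : x j = 0 := by simpa [mem_supp] using hj
  -- exchange the entry `i` of the support for the entry `j`
  let z : EuclideanSpace ℝ (Fin n) :=
    WithLp.toLp 2 (Function.update (Function.update x.ofLp i 0) j (u j))
  have hsub : supp z ⊆ insert j ((supp x).erase i) := by
    intro r hr
    by_cases hrj : r = j
    · simp [hrj]
    · by_cases hri : r = i
      · subst hri
        simp [mem_supp, z, hrj] at hr
      · simpa [mem_supp, z, hri, hrj] using hr
  have hz : z ∈ P.sparse := by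
    refine (Finset.card_le_card hsub).trans ((Finset.card_insert_le _ _).trans ?_)
    rw [Finset.card_erase_add_one hi]
    exact h.card_supp_le
  have hzx : z ≠ x := fun h0 => by
    have := congrArg (fun y => y.ofLp i) h0
    simp only [z, Function.update_of_ne hij, Function.update_self] at this
    exact mem_supp.1 hi this.symm
  have hlt := pow_lt_pow_left₀ (h.norm_lt hz hzx) (norm_nonneg _) two_ne_zero
  have hsum := norm_sub_sq_sub x z u
  rw [Fintype.sum_eq_add i j hij fun r hr => by simp [z, hr.1, hr.2]] at hsum
  simp only [z, Function.update_of_ne hij, Function.update_self, hui, hxj] at hsum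
  rw [← sq_lt_sq, hui]
  linarith

theorem supp_subset_of_mem_TSet {Y : YSpace n k m} (h : P.IsPStationary τ Ys)
    (hY : ∀ i ∈ supp (xPart Ys), ∀ j ∉ supp (xPart Ys), |P.uVec τ Y j| < |P.uVec τ Y i|)
    {T : Finset (Fin n)} (hT : T ∈ P.TSet τ Y) : supp (xPart Ys) ⊆ T := by
  intro i hi
  by_contra hiT
  -- otherwise all of `T` would lie in the support, which has at most `s = |T|` elements
  have hsub : T ⊆ (supp (xPart Ys)).erase i := by
    intro j hj
    refine Finset.mem_erase.2 ⟨fun h0 => hiT (h0 ▸ hj), ?_⟩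
    by_contra hjs
    exact absurd (hT.2 j hj i hiT) (not_le.2 (hY i hi j hjs))
  have h1 := Finset.card_le_card hsub
  have h2 := Finset.card_erase_add_one hi
  have h3 := h.card_supp_le
  have h4 := hT.1
  omega

theorem supp_subset (h : P.IsPStationary τ Ys) {T : Finset (Fin n)} (hT : T ∈ P.TSet τ Ys) :
    supp (xPart Ys) ⊆ T :=
  h.supp_subset_of_mem_TSet (fun _ hi _ hj => h.uVec_lt hi hj) hT

theorem supp_eq_or_card_lt (h : P.IsPStationary τ Ys) {T : Finset (Fin n)}
    (hsub : supp (xPart Ys) ⊆ T) (hT : T.card = P.s) :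
    supp (xPart Ys) = T ∨ (supp (xPart Ys)).card < P.s := by
  rcases h.card_supp_le.lt_or_eq with h1 | h1
  · exact .inr h1
  · exact .inl (Finset.eq_of_subset_of_card_le hsub (by omega))

/-- Near a P-stationary point only its own index sets are selected. -/
theorem eventually_TSet_subset (h : P.IsPStationary τ Ys) :
    ∀ᶠ Y in 𝓝 Ys, P.TSet τ Y ⊆ P.TSet τ Ys := by
  have hsep : ∀ᶠ Y in 𝓝 Ys, ∀ i ∈ supp (xPart Ys), ∀ j, j ∉ supp (xPart Ys) →
      |P.uVec τ Y j| < |P.uVec τ Y i| := by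
    refine (Finset.eventually_all _).2 fun i hi => eventually_all.2 fun j => ?_
    by_cases hj : j ∈ supp (xPart Ys)
    · exact .of_forall fun _ h0 => absurd hj h0
    · have hc := (P.continuous_uVec_apply τ j).abs.tendsto Ys
      filter_upwards [hc.eventually_lt ((P.continuous_uVec_apply τ i).abs.tendsto Ys)
        (h.uVec_lt hi hj)] with Y hY _ using hY
  filter_upwards [hsep] with Y hY T hT
  have hsub := h.supp_subset_of_mem_TSet hY hT
  refine ⟨hT.1, fun i hi j hj => ?_⟩
  rcases h.supp_eq_or_card_lt hsub hT.1 with h0 | h0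
  · exact (h.uVec_lt (h0 ▸ hi) (h0 ▸ hj)).le
  · have hxj : xPart Ys j = 0 := by
      by_contra hne
      exact hj (hsub (mem_supp.2 hne))
    rw [h.uVec_apply (.inr h0), hxj, abs_zero]
    exact abs_nonneg _

/-- The stationarity equation holds on all of `T`, not only on the support: if the support is
smaller than `T`, its cardinality is below `s` and every coordinate is free. -/
theorem gradL_add_nu (h : P.IsPStationary τ Ys) (hτ : 0 < τ) {T : Finset (Fin n)}
    (hT : T ∈ P.TSet τ Ys) {i : Fin n} (hi : i ∈ T) :
    P.gradL (xPart Ys) (muPart Ys) (lamPart Ys) i + nuPart Ys i = 0 := by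
  have hu : P.uVec τ Ys i = xPart Ys i := by
    refine h.uVec_apply ?_
    rcases h.supp_eq_or_card_lt (h.supp_subset hT) hT.1 with h0 | h0
    · exact .inl (h0 ▸ hi)
    · exact .inr h0
  simp only [uVec, PiLp.sub_apply, PiLp.smul_apply, PiLp.add_apply, smul_eq_mul, sub_eq_self,
    mul_eq_zero, hτ.ne', false_or] at hu
  exact hu

/-- Off the support both `x_i` and `ν_i` vanish, and `0 ∈ X_i`. -/
theorem proj_eq (h : P.IsPStationary τ Ys) (i : Fin n) :
    proj (P.X i) (xPart Ys i + nuPart Ys i) = xPart Ys i := by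
  by_cases hi : i ∈ supp (xPart Ys)
  · exact (h.box_proj i hi).symm
  · have hx : xPart Ys i = 0 := by simpa [mem_supp] using hi
    rw [h.nu_zero i hi, hx, add_zero]
    exact proj_of_mem (P.X_closed i) (P.X_interval i) (P.zero_mem_X i)

theorem lam_mul (h : P.IsPStationary τ Ys) (j : Fin m) :
    lamPart Ys j * (P.lin j (xPart Ys) - P.b j) = 0 :=
  (Finset.sum_eq_zero_iff_of_nonpos fun j _ =>
    mul_nonpos_of_nonneg_of_nonpos (h.lam_nonneg j) (h.lin_le j)).1 h.lam_compl j
    (Finset.mem_univ j)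

theorem F_eq_zero (h : P.IsPStationary τ Ys) (hτ : 0 < τ) {T : Finset (Fin n)}
    (hT : T ∈ P.TSet τ Ys) : P.F T Ys = 0 := by
  ext r
  rcases r with i | i | i | j <;> simp only [F, Sum.elim_inl, Sum.elim_inr, PiLp.zero_apply]
  · split_ifs with hi
    · exact h.gradL_add_nu hτ hT hi
    · by_contra hne
      exact hi (h.supp_subset hT (mem_supp.2 hne))
  · split_ifs with hi
    · rw [h.proj_eq, sub_self]
    · exact h.nu_zero i fun h0 => hi (h.supp_subset hT h0)
  · exact fischerBurmeister_eq_zero (by linarith [h.quad_le i]) (h.mu_nonneg i)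
      (by linarith [h.mu_compl i])
  · exact fischerBurmeister_eq_zero (by linarith [h.lin_le j]) (h.lam_nonneg j)
      (by linarith [h.lam_mul j])

end IsPStationary

/-! ### Nonsingularity at the solution -/

/-- The quadratic form that results from pairing the rows of `∇ₓL + ν` with the direction. -/
theorem sum_mul_gradLDeriv (P : Problem n k m) (Y v : YSpace n k m) :
    ∑ i, xPart v i * P.gradLDeriv Y v i =
      (xPart v).ofLp ⬝ᵥ (P.hessL (muPart Y)).mulVec (xPart v).ofLp + ∑ i, xPart v i * nuPart v i
        + ∑ j, muPart v j * inner ℝ (P.gradf j (xPart Y)) (xPart v)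
        + ∑ j, lamPart v j * P.lin j (xPart v) := by
  have h1 : ∑ i, xPart v i * ∑ j, muPart v j * P.gradf j (xPart Y) i =
      ∑ j, muPart v j * inner ℝ (P.gradf j (xPart Y)) (xPart v) := by
    simp only [Finset.mul_sum, EuclideanSpace.inner_eq_star_dotProduct, star_trivial, dotProduct]
    rw [Finset.sum_comm]
    exact Finset.sum_congr rfl fun j _ => Finset.sum_congr rfl fun i _ => by ring
  have h2 : ∑ i, xPart v i * ∑ j, lamPart v j * P.A j i =
      ∑ j, lamPart v j * P.lin j (xPart v) := by
    simp only [Finset.mul_sum, lin, dotProduct]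
    rw [Finset.sum_comm]
    exact Finset.sum_congr rfl fun j _ => Finset.sum_congr rfl fun i _ => by ring
  simp only [gradLDeriv, mul_add, Finset.sum_add_distrib, h1, h2]
  rfl

/-- At the solution every model Jacobian is injective: pairing the first rows with the direction
gives a vanishing sum of nonnegative terms, so the second-order condition annihilates the `x`-part,
and the restricted LICQ the multipliers. -/
theorem modelJac_injective (h : P.IsPStationary τ Ys) (hlicq : P.RestrictedLICQ (xPart Ys))
    {T : Finset (Fin n)} (hT : T ∈ P.TSet τ Ys) (hsoc : P.StrongSOC Ys T) {p : Coef n k m}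
    (hp : P.IsSelection T Ys Ys p) {v : YSpace n k m} (hv : P.modelJac T Ys p v = 0) : v = 0 := by
  have hrow : ∀ r, P.modelJac T Ys p v r = 0 := fun r => by rw [hv]; rfl
  have hgrad : ∀ i ∈ T, P.gradLDeriv Ys v i = 0 := fun i hi => by
    simpa [modelJac, hi] using hrow (Sum.inl i)
  have hx : ∀ i ∉ T, xPart v i = 0 := fun i hi => by
    simpa [modelJac, hi] using hrow (Sum.inl i)
  have hbox : ∀ i ∈ T, xPart v i - p.1 i * (xPart v i + nuPart v i) = 0 := fun i hi => by
    simpa [modelJac, hi] using hrow (Sum.inr (Sum.inl i))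
  have hnu : ∀ i ∉ T, nuPart v i = 0 := fun i hi => by
    simpa [modelJac, hi] using hrow (Sum.inr (Sum.inl i))
  have hquad : ∀ i, (p.2.1 i).1 * -inner ℝ (P.gradf i (xPart Ys)) (xPart v)
      + (p.2.1 i).2 * muPart v i = 0 := fun i => hrow (Sum.inr (Sum.inr (Sum.inl i)))
  have hlin : ∀ j, (p.2.2 j).1 * -P.lin j (xPart v) + (p.2.2 j).2 * lamPart v j = 0 :=
    fun j => hrow (Sum.inr (Sum.inr (Sum.inr j)))
  have hcone : xPart v ∈ P.coneQ Ys T := by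
    refine ⟨fun i hi hf => ?_, fun j hj hl => ?_, fun i hi hne hfr => ?_⟩
    · have hq := hp.quad i
      rw [hf, neg_zero] at hq
      obtain ⟨h1, h2⟩ := hq.of_zero_pos hi
      have h3 := hquad i
      rw [h1, h2] at h3
      linarith
    · have hq := hp.linear j
      rw [hl, sub_self] at hq
      obtain ⟨h1, h2⟩ := hq.of_zero_pos hj
      have h3 := hlin j
      rw [h1, h2] at h3
      linarith
    · have hout : xPart Ys i + nuPart Ys i ∉ P.X i := by
        intro hmem
        have h1 := proj_of_mem (P.X_closed i) (P.X_interval i) hmem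
        rw [h.proj_eq] at h1
        exact hne (by linarith)
      have h3 := hbox i hi
      rw [hp.outside i hi hout] at h3
      linarith
  have hsum : ∑ i, xPart v i * P.gradLDeriv Ys v i = 0 :=
    Finset.sum_eq_zero fun i _ => by
      by_cases hi : i ∈ T
      · rw [hgrad i hi, mul_zero]
      · rw [hx i hi, zero_mul]
  rw [sum_mul_gradLDeriv] at hsum
  have hnn1 : 0 ≤ ∑ i, xPart v i * nuPart v i := Finset.sum_nonneg fun i _ => by
    by_cases hi : i ∈ T
    · obtain ⟨h0, h1⟩ := hp.mem_Icc i
      have h3 := hbox i hi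
      rcases h0.eq_or_lt with h0 | h0
      · have : xPart v i = 0 := by rw [← h0] at h3; linarith
        rw [this, zero_mul]
      · -- `δ (x ν) = (1 - δ) x²`
        have h4 : p.1 i * (xPart v i * nuPart v i) = (1 - p.1 i) * xPart v i ^ 2 := by
          linear_combination -xPart v i * h3
        by_contra! hneg
        nlinarith [mul_nonneg (sub_nonneg.2 h1) (sq_nonneg (xPart v i))]
    · rw [hx i hi, zero_mul]
  have hnn2 : 0 ≤ ∑ j, muPart v j * inner ℝ (P.gradf j (xPart Ys)) (xPart v) :=
    Finset.sum_nonneg fun j _ => (hp.quad j).mul_nonneg (hquad j)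
  have hnn3 : 0 ≤ ∑ j, lamPart v j * P.lin j (xPart v) :=
    Finset.sum_nonneg fun j _ => (hp.linear j).mul_nonneg (hlin j)
  have hx0 : xPart v = 0 := by
    by_contra hne
    have := hsoc _ hcone hne
    linarith
  have hmu : ∀ i, ¬ P.f i (xPart Ys) = 0 → muPart v i = 0 := by
    intro i hi
    have hneg : P.f i (xPart Ys) < 0 := lt_of_le_of_ne (h.quad_le i) hi
    have hq := hp.quad i
    rw [(mul_eq_zero.1 (h.mu_compl i)).resolve_right hi] at hq
    obtain ⟨h1, h2⟩ := hq.of_pos_zero (by linarith)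
    have h3 := hquad i
    rw [h1, h2] at h3
    linarith
  have hlam : ∀ j, ¬ P.lin j (xPart Ys) = P.b j → lamPart v j = 0 := by
    intro j hj
    have hneg : P.lin j (xPart Ys) - P.b j < 0 :=
      lt_of_le_of_ne (h.lin_le j) fun h0 => hj (sub_eq_zero.1 h0)
    have hq := hp.linear j
    rw [(mul_eq_zero.1 (h.lam_mul j)).resolve_right hneg.ne] at hq
    obtain ⟨h1, h2⟩ := hq.of_pos_zero (by linarith)
    have h3 := hlin j
    rw [h1, h2] at h3
    linarith
  -- at an interior point `ν_i = 0` at the solution, so the projection has derivative `1` there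
  have hnu' : ∀ i, ¬ (i ∈ T ∧ xPart Ys i ∈ frontier (P.X i)) → nuPart v i = 0 := by
    intro i hi
    by_cases hiT : i ∈ T
    swap
    · exact hnu i hiT
    have hint : xPart Ys i ∈ interior (P.X i) := by
      by_contra hni
      exact hi ⟨hiT, subset_closure (hlicq.1.2.2 i), hni⟩
    have hproj := h.proj_eq i
    have h1 := eq_proj_of_proj_mem_interior (P.X_closed i) (P.X_interval i) (hproj.symm ▸ hint)
    have h3 := hbox i hiT
    rw [hp.inside i hiT (by rw [← h1, hproj]; exact hint)] at h3
    linarith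
  classical
  -- on the support the first rows now read as a relation between the vectors of the LICQ
  have hind := Fintype.linearIndependent_iff.1 (hlicq.2 T ⟨hT.1, h.supp_subset hT⟩)
    (Sum.elim (fun i => muPart v i) (Sum.elim (fun j => lamPart v j) fun i => nuPart v i)) (by
      funext r
      have hr := hgrad r (h.supp_subset hT r.2)
      rw [gradLDeriv, hx0] at hr
      simp only [Fintype.sum_sum_type, Sum.elim_inl, Sum.elim_inr, Finset.sum_apply,
        Pi.smul_apply, smul_eq_mul, Pi.zero_apply]
      rw [sum_subtype_eq_sum (g := fun i => muPart v i * P.gradf i (xPart Ys) r)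
          fun i hi => by rw [hmu i hi, zero_mul],
        sum_subtype_eq_sum (g := fun j => lamPart v j * P.A j r)
          fun j hj => by rw [hlam j hj, zero_mul],
        sum_subtype_eq_sum (g := fun i => nuPart v i * (Pi.single i (1 : ℝ) : Fin n → ℝ) r)
          fun i hi => by rw [hnu' i hi, zero_mul]]
      have hs : ∑ i, nuPart v i * (Pi.single i (1 : ℝ) : Fin n → ℝ) r = nuPart v r := by
        simp [Pi.single_apply]
      rw [hs]
      simp only [WithLp.ofLp_zero, Matrix.mulVec_zero, Pi.zero_apply] at hr
      linarith)
  ext r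
  rcases r with i | i | i | j
  · exact congrArg (fun y => y.ofLp i) hx0
  · by_cases hi : i ∈ T ∧ xPart Ys i ∈ frontier (P.X i)
    · exact hind (Sum.inr (Sum.inr ⟨i, hi⟩))
    · exact hnu' i hi
  · by_cases hi : P.f i (xPart Ys) = 0
    · exact hind (Sum.inl ⟨i, hi⟩)
    · exact hmu i hi
  · by_cases hj : P.lin j (xPart Ys) = P.b j
    · exact hind (Sum.inr (Sum.inl ⟨j, hj⟩))
    · exact hlam j hj

end Problem

/-! ### Estimates near the solution -/

/-- Strong semismoothness of the composed Fischer-Burmeister function at a complementary pair: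
by Euler's relation the error of the generalized linearization reduces to this expression. -/
theorem exists_isFBGrad_error_bound {E : Type*} [NormedAddCommGroup E] {a b : E → ℝ}
    (ha : LocallyLipschitz a) (hb : LocallyLipschitz b) (y₀ : E) (ha₀ : 0 ≤ a y₀)
    (hb₀ : 0 ≤ b y₀) (hab : a y₀ * b y₀ = 0) :
    ∃ c, ∀ᶠ y in 𝓝 y₀, ∀ q, IsFBGrad (a y) (b y) q →
      |q.1 * a y₀ + q.2 * b y₀| ≤ c * ‖y - y₀‖ ^ 2 := by
  have key : ∀ {g : E → ℝ}, LocallyLipschitz g → g y₀ = 0 →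
      ∃ K : ℝ, ∀ᶠ y in 𝓝 y₀, g y ^ 2 ≤ K * ‖y - y₀‖ ^ 2 := by
    intro g hg hg₀
    obtain ⟨K, t, ht, hK⟩ := hg y₀
    refine ⟨(K : ℝ) ^ 2, ?_⟩
    filter_upwards [ht] with y hy
    have := hK.dist_le_mul y hy y₀ (mem_of_mem_nhds ht)
    rw [Real.dist_eq, hg₀, sub_zero, dist_eq_norm] at this
    rw [← mul_pow, ← sq_abs (g y)]
    exact pow_le_pow_left₀ (abs_nonneg _) this 2
  rcases mul_eq_zero.1 hab with h0 | h0
  · rcases hb₀.eq_or_lt with h1 | h1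
    · exact ⟨0, .of_forall fun y q _ => by simp [h0, ← h1]⟩
    · obtain ⟨K, hK⟩ := key ha h0
      refine ⟨4 / b y₀ * K, ?_⟩
      filter_upwards [hK, (hb.continuous.tendsto y₀).eventually_const_lt (half_lt_self h1)]
        with y hy hby q hq
      rw [h0, mul_zero, zero_add, mul_assoc]
      exact (hq.snd_bound h1 hby).trans (mul_le_mul_of_nonneg_left hy (by positivity))
  · rcases ha₀.eq_or_lt with h1 | h1
    · exact ⟨0, .of_forall fun y q _ => by simp [h0, ← h1]⟩
    · obtain ⟨K, hK⟩ := key hb h0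
      refine ⟨4 / a y₀ * K, ?_⟩
      filter_upwards [hK, (ha.continuous.tendsto y₀).eventually_const_lt (half_lt_self h1)]
        with y hy hay q hq
      rw [h0, mul_zero, add_zero, mul_assoc]
      exact (hq.fst_bound h1 hay).trans (mul_le_mul_of_nonneg_left hy (by positivity))

theorem abs_dotProduct_mulVec_le {n : ℕ} (Q : Matrix (Fin n) (Fin n) ℝ)
    (d : EuclideanSpace ℝ (Fin n)) : |d.ofLp ⬝ᵥ Q.mulVec d.ofLp| ≤
      ‖Matrix.toEuclideanCLM (n := Fin n) (𝕜 := ℝ) Q‖ * ‖d‖ ^ 2 := by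
  have h1 : d.ofLp ⬝ᵥ Q.mulVec d.ofLp =
      inner ℝ (Matrix.toEuclideanCLM (n := Fin n) (𝕜 := ℝ) Q d) d := by
    simp [EuclideanSpace.inner_eq_star_dotProduct, Matrix.ofLp_toEuclideanCLM]
  rw [h1]
  have h2 := abs_real_inner_le_norm (Matrix.toEuclideanCLM (n := Fin n) (𝕜 := ℝ) Q d) d
  have h3 := (Matrix.toEuclideanCLM (n := Fin n) (𝕜 := ℝ) Q).le_opNorm d
  nlinarith [norm_nonneg d]

namespace Problem

variable {n k m : ℕ} {P : Problem n k m} {τ : ℝ} {Ys : YSpace n k m}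

/-- If the model Jacobians at `Ys` are injective, those near `Ys` are uniformly so, by
compactness. -/
theorem exists_modelJac_lower_bound {T : Finset (Fin n)}
    (hinj : ∀ p, P.IsSelection T Ys Ys p → ∀ v, P.modelJac T Ys p v = 0 → v = 0) :
    ∃ c, 0 < c ∧ ∀ᶠ Y in 𝓝 Ys, ∀ p, P.IsSelection T Ys Y p → ∀ v, ‖v‖ = 1 →
      c ≤ ‖P.modelJac T Y p v‖ := by
  have hK : IsCompact (Metric.closedBall (0 : Coef n k m) 2 ×ˢ
      Metric.sphere (0 : YSpace n k m) 1) := (isCompact_closedBall _ _).prod (isCompact_sphere _ _)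
  have hclosed : IsClosed {z : Coef n k m × YSpace n k m | P.IsSelection T Ys Ys z.1} :=
    (P.isClosed_isSelection T Ys).preimage
      (by fun_prop : Continuous fun z : Coef n k m × YSpace n k m => (Ys, z.1))
  have hcont : Continuous fun z : YSpace n k m × Coef n k m × YSpace n k m =>
      ‖P.modelJac T z.1 z.2.1 z.2.2‖ := by fun_prop
  have hcont' : Continuous fun z : Coef n k m × YSpace n k m => ‖P.modelJac T Ys z.1 z.2‖ := by
    fun_prop
  have hpos : ∀ z ∈ Metric.closedBall (0 : Coef n k m) 2 ×ˢ Metric.sphere (0 : YSpace n k m) 1 ∩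
      {z : Coef n k m × YSpace n k m | P.IsSelection T Ys Ys z.1},
      0 < ‖P.modelJac T Ys z.1 z.2‖ := by
    intro z hz
    refine norm_pos_iff.2 fun h0 => ?_
    have hv := hz.1.2
    rw [mem_sphere_zero_iff_norm, hinj z.1 hz.2 z.2 h0, norm_zero] at hv
    exact zero_ne_one hv
  have hmin : ∃ c, 0 < c ∧ ∀ z ∈ Metric.closedBall (0 : Coef n k m) 2 ×ˢ
      Metric.sphere (0 : YSpace n k m) 1 ∩
      {z : Coef n k m × YSpace n k m | P.IsSelection T Ys Ys z.1},
      c ≤ ‖P.modelJac T Ys z.1 z.2‖ :=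
    (hK.inter_right hclosed).exists_forall_le' hcont'.continuousOn hpos
  obtain ⟨c, hc, hcle⟩ := hmin
  refine ⟨c / 2, half_pos hc, ?_⟩
  have hev := hK.eventually_forall_of_forall_eventually (x₀ := Ys)
    (P := fun Y z => P.IsSelection T Ys Y z.1 → c / 2 ≤ ‖P.modelJac T Y z.1 z.2‖) (by
      rintro ⟨p, v⟩ hz
      by_cases hp : P.IsSelection T Ys Ys p
      · filter_upwards [(hcont.tendsto (Ys, p, v)).eventually_const_lt
          ((half_lt_self hc).trans_le (hcle (p, v) ⟨hz, hp⟩))] with z h _ using h.le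
      · have hsel : Continuous fun z : YSpace n k m × Coef n k m × YSpace n k m =>
            (z.1, z.2.1) := by
          fun_prop
        have hmem := (P.isClosed_isSelection T Ys).isOpen_compl.mem_nhds (x := (Ys, p)) hp
        filter_upwards [hsel.tendsto (Ys, p, v) hmem] with z h h' using absurd h' h)
  filter_upwards [hev] with Y hY p hp v hv
  exact hY (p, v) ⟨hp.mem_closedBall, by simpa using hv⟩ hp

/-- The generalized linearization of `F` at `Y` predicts the zero `Ys` up to a quadratic error. -/
theorem exists_modelJac_error_bound (h : P.IsPStationary τ Ys) (hτ : 0 < τ) {T : Finset (Fin n)}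
    (hT : T ∈ P.TSet τ Ys) :
    ∃ c, ∀ᶠ Y in 𝓝 Ys, ∀ p, P.IsSelection T Ys Y p →
      ‖P.F T Y - P.modelJac T Y p (Y - Ys)‖ ≤ c * ‖Y - Ys‖ ^ 2 := by
  suffices hrow : ∀ r, ∃ c, ∀ᶠ Y in 𝓝 Ys, ∀ p, P.IsSelection T Ys Y p →
      |(P.F T Y - P.modelJac T Y p (Y - Ys)) r| ≤ c * ‖Y - Ys‖ ^ 2 by
    choose c hc using hrow
    refine ⟨∑ r, c r, ?_⟩
    filter_upwards [eventually_all.2 hc] with Y hY p hp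
    rw [Finset.sum_mul]
    exact (norm_le_sum_abs _).trans (Finset.sum_le_sum fun r _ => hY r p hp)
  intro r
  rcases r with i | i | i | j <;>
    simp only [PiLp.sub_apply, F, modelJac, Sum.elim_inl, Sum.elim_inr]
  · by_cases hi : i ∈ T
    swap
    · have hx : xPart Ys i = 0 := by
        by_contra hne
        exact hi (h.supp_subset hT (mem_supp.2 hne))
      refine ⟨0, .of_forall fun Y p _ => ?_⟩
      rw [xPart_apply] at hx
      simp [hi, hx]
    · refine ⟨∑ j, ‖Matrix.toEuclideanCLM (n := Fin n) (𝕜 := ℝ) (P.Q j)‖,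
        .of_forall fun Y p _ => ?_⟩
      simp only [hi, if_true]
      -- the expansion of the bilinear gradient at `Y`, evaluated at `Ys`
      have hexp := P.gradL_add Y ((-1 : ℝ) • (Y - Ys)) i
      rw [show Y + (-1 : ℝ) • (Y - Ys) = Ys by module, h.gradL_add_nu hτ hT hi,
        gradLDeriv_smul] at hexp
      have hrem : P.gradL (xPart Y) (muPart Y) (lamPart Y) i + nuPart Y i
          - P.gradLDeriv Y (Y - Ys) i =
          -∑ j, muPart (Y - Ys) j * (P.Q j).mulVec (xPart (Y - Ys)).ofLp i := by
        have : ∑ j, muPart ((-1 : ℝ) • (Y - Ys)) j *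
            (P.Q j).mulVec (xPart ((-1 : ℝ) • (Y - Ys))).ofLp i =
            ∑ j, muPart (Y - Ys) j * (P.Q j).mulVec (xPart (Y - Ys)).ofLp i := by
          refine Finset.sum_congr rfl fun j _ => ?_
          simp only [xPart_smul, WithLp.ofLp_smul, Matrix.mulVec_smul, Pi.smul_apply,
            muPart_apply, PiLp.smul_apply, smul_eq_mul]
          ring
        rw [this] at hexp
        linarith
      rw [hrem, abs_neg, Finset.sum_mul]
      refine (Finset.abs_sum_le_sum_abs _ _).trans (Finset.sum_le_sum fun j _ => ?_)
      rw [abs_mul]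
      have h1 : |muPart (Y - Ys) j| ≤ ‖Y - Ys‖ :=
        abs_apply_le_norm (Y - Ys) (Sum.inr (Sum.inr (Sum.inl j)))
      have h2 := (abs_mulVec_apply_le (P.Q j) (xPart (Y - Ys)) i).trans
        (mul_le_mul_of_nonneg_left (norm_xPart_le _) (norm_nonneg _))
      calc _ ≤ ‖Y - Ys‖ * (‖Matrix.toEuclideanCLM (n := Fin n) (𝕜 := ℝ) (P.Q j)‖ * ‖Y - Ys‖) :=
            mul_le_mul h1 h2 (abs_nonneg _) (norm_nonneg _)
        _ = _ := by ring
  · refine ⟨0, .of_forall fun Y p hp => ?_⟩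
    by_cases hi : i ∈ T
    · have hs := hp.secant i hi
      rw [h.proj_eq] at hs
      simp only [xPart_apply, nuPart_apply] at hs
      have : xPart Y i - proj (P.X i) (xPart Y i + nuPart Y i) - (xPart (Y - Ys) i
          - p.1 i * (xPart (Y - Ys) i + nuPart (Y - Ys) i)) = 0 := by
        simp only [xPart_apply, nuPart_apply, PiLp.sub_apply]
        linear_combination hs
      simp only [hi, if_true, this, abs_zero, zero_mul, le_refl]
    · have hx : nuPart Ys i = 0 := h.nu_zero i fun h0 => hi (h.supp_subset hT h0)
      rw [nuPart_apply] at hx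
      simp [hi, hx]
  · obtain ⟨c, hc⟩ := exists_isFBGrad_error_bound
      (a := fun Y => -(P.f i (xPart Y))) (b := fun Y : YSpace n k m => muPart Y i)
      (P.contDiff_f_xPart i).neg.locallyLipschitz
      (ContDiff.locallyLipschitz (𝕂 := ℝ) (by simp only [muPart_apply]; fun_prop)) Ys
      (by linarith [h.quad_le i]) (h.mu_nonneg i) (by linarith [h.mu_compl i])
    refine ⟨‖Matrix.toEuclideanCLM (n := Fin n) (𝕜 := ℝ) (P.Q i)‖ + c, ?_⟩
    filter_upwards [hc] with Y hY p hp
    have hq := hp.quad i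
    have hexp := P.f_add i (xPart Y) ((-1 : ℝ) • xPart (Y - Ys))
    rw [xPart_sub, show xPart Y + (-1 : ℝ) • (xPart Y - xPart Ys) = xPart Ys by module,
      ← xPart_sub, inner_smul_right, WithLp.ofLp_smul, Matrix.mulVec_smul, smul_dotProduct,
      dotProduct_smul, smul_eq_mul, smul_eq_mul] at hexp
    have hsplit : fischerBurmeister (-P.f i (xPart Y)) (muPart Y i) -
        ((p.2.1 i).1 * -inner ℝ (P.gradf i (xPart Y)) (xPart (Y - Ys))
          + (p.2.1 i).2 * muPart (Y - Ys) i) =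
        (p.2.1 i).1 * (1 / 2) * ((xPart (Y - Ys)).ofLp ⬝ᵥ (P.Q i).mulVec (xPart (Y - Ys)).ofLp)
        + ((p.2.1 i).1 * -P.f i (xPart Ys) + (p.2.1 i).2 * muPart Ys i) := by
      rw [hq.euler]
      simp only [muPart_apply, PiLp.sub_apply]
      linear_combination (p.2.1 i).1 * hexp
    rw [hsplit, add_mul]
    refine (abs_add_le _ _).trans (add_le_add ?_ (hY _ hq))
    rw [abs_mul]
    have h1 : |(p.2.1 i).1 * (1 / 2)| ≤ 1 := by
      rw [abs_mul, abs_of_pos (by norm_num : (0 : ℝ) < 1 / 2)]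
      linarith [hq.abs_le.1]
    have h2 := (abs_dotProduct_mulVec_le (P.Q i) (xPart (Y - Ys))).trans
      (mul_le_mul_of_nonneg_left (pow_le_pow_left₀ (norm_nonneg _) (norm_xPart_le _) 2)
        (norm_nonneg _))
    calc _ ≤ 1 * (‖Matrix.toEuclideanCLM (n := Fin n) (𝕜 := ℝ) (P.Q i)‖ * ‖Y - Ys‖ ^ 2) :=
          mul_le_mul h1 h2 (abs_nonneg _) zero_le_one
      _ = _ := one_mul _
  · obtain ⟨c, hc⟩ := exists_isFBGrad_error_bound
      (a := fun Y => P.b j - P.lin j (xPart Y)) (b := fun Y : YSpace n k m => lamPart Y j)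
      (contDiff_const.sub (P.contDiff_lin_xPart j)).locallyLipschitz
      (ContDiff.locallyLipschitz (𝕂 := ℝ) (by simp only [lamPart_apply]; fun_prop)) Ys
      (by linarith [h.lin_le j]) (h.lam_nonneg j) (by linarith [h.lam_mul j])
    refine ⟨c, ?_⟩
    filter_upwards [hc] with Y hY p hp
    have hq := hp.linear j
    have hexp := P.lin_add j (xPart Ys) (xPart (Y - Ys))
    rw [xPart_sub, add_sub_cancel, ← xPart_sub] at hexp
    have hsplit : fischerBurmeister (P.b j - P.lin j (xPart Y)) (lamPart Y j) -
        ((p.2.2 j).1 * -P.lin j (xPart (Y - Ys)) + (p.2.2 j).2 * lamPart (Y - Ys) j) =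
        (p.2.2 j).1 * (P.b j - P.lin j (xPart Ys)) + (p.2.2 j).2 * lamPart Ys j := by
      rw [hq.euler]
      simp only [lamPart_apply, PiLp.sub_apply]
      linear_combination -(p.2.2 j).1 * hexp
    rw [hsplit]
    exact hY _ hq

/-- The estimates for a Newton step from `Y` towards `Ys`, with one constant `C`: the elements `W`
of the generalized Jacobian have the model form, `W⁻¹` is bounded by `C`, `F` is Lipschitz at its zero
`Ys`, and the generalized linearization has a quadratic error. -/
structure NewtonEstimate (P : Problem n k m) (Ys : YSpace n k m) (T : Finset (Fin n)) (C : ℝ)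
    (Y : YSpace n k m) : Prop where
  norm_F_le : ‖P.F T Y‖ ≤ C * ‖Y - Ys‖
  model : ∀ W ∈ P.genJac T Y, ∃ p, ∀ v,
    Matrix.toEuclideanCLM (n := Idx n k m) (𝕜 := ℝ) W v = P.modelJac T Y p v
  norm_le : ∀ W ∈ P.genJac T Y, ∀ v,
    ‖v‖ ≤ C * ‖Matrix.toEuclideanCLM (n := Idx n k m) (𝕜 := ℝ) W v‖
  error_le : ∀ W ∈ P.genJac T Y,
    ‖P.F T Y - Matrix.toEuclideanCLM (n := Idx n k m) (𝕜 := ℝ) W (Y - Ys)‖ ≤ C * ‖Y - Ys‖ ^ 2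

theorem NewtonEstimate.mono {T : Finset (Fin n)} {C C' : ℝ} {Y : YSpace n k m}
    (h : P.NewtonEstimate Ys T C Y) (hC : C ≤ C') : P.NewtonEstimate Ys T C' Y where
  norm_F_le := h.norm_F_le.trans (by gcongr)
  model := h.model
  norm_le W hW v := (h.norm_le W hW v).trans (by gcongr)
  error_le W hW := (h.error_le W hW).trans (by gcongr)

theorem exists_newtonEstimate (h : P.IsPStationary τ Ys) (hτ : 0 < τ)
    (hlicq : P.RestrictedLICQ (xPart Ys)) {T : Finset (Fin n)} (hT : T ∈ P.TSet τ Ys)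
    (hsoc : P.StrongSOC Ys T) : ∃ C, ∀ᶠ Y in 𝓝 Ys, P.NewtonEstimate Ys T C Y := by
  obtain ⟨c, hc, hlow⟩ := exists_modelJac_lower_bound (T := T) (P := P) (Ys := Ys)
    fun p hp v hv => P.modelJac_injective h hlicq hT hsoc hp hv
  obtain ⟨e, herr⟩ := exists_modelJac_error_bound h hτ hT
  obtain ⟨L, t, ht, hL⟩ := P.locallyLipschitz_F T Ys
  refine ⟨max (L : ℝ) (max c⁻¹ e), ?_⟩
  filter_upwards [hlow, herr, ht,
    P.clarkeJacobian_subset_model T Ys (P.fderiv_F_eq_modelJac T Ys)] with Y hlow herr hY hmodel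
  refine ⟨?_, fun W hW => ?_, fun W hW v => ?_, fun W hW => ?_⟩
  · have h1 := hL.dist_le_mul Y hY Ys (mem_of_mem_nhds ht)
    rw [dist_eq_norm, dist_eq_norm, h.F_eq_zero hτ hT, sub_zero] at h1
    exact h1.trans (by gcongr; exact le_max_left _ _)
  · obtain ⟨p, -, hp⟩ := hmodel _ hW
    exact ⟨p, hp⟩
  · obtain ⟨p, hp, hpv⟩ := hmodel _ hW
    rcases eq_or_ne v 0 with rfl | hv
    · simp
    have h1 := hlow p hp (‖v‖⁻¹ • v) (norm_smul_inv_norm hv)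
    rw [← hpv, map_smul, norm_smul, norm_inv, norm_norm, ← div_eq_inv_mul,
      le_div_iff₀ (norm_pos_iff.2 hv)] at h1
    calc ‖v‖ ≤ c⁻¹ * ‖Matrix.toEuclideanCLM (n := Idx n k m) (𝕜 := ℝ) W v‖ := by
          rw [← div_eq_inv_mul, le_div_iff₀ hc, mul_comm]
          exact h1
      _ ≤ _ := by
          gcongr
          exact (le_max_left _ _).trans (le_max_right _ _)
  · obtain ⟨p, hp, hpv⟩ := hmodel _ hW
    rw [hpv]
    exact (herr p hp).trans (by gcongr; exact (le_max_right _ _).trans (le_max_right _ _))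

/-- One constant serves all index sets selected near a P-stationary point. -/
theorem exists_uniform_newtonEstimate (h : P.IsPStationary τ Ys) (hτ : 0 < τ)
    (hlicq : P.RestrictedLICQ (xPart Ys)) (hsoc : ∀ T ∈ P.TSet τ Ys, P.StrongSOC Ys T) :
    ∃ C, 1 ≤ C ∧ ∀ᶠ Y in 𝓝 Ys, ∀ T ∈ P.TSet τ Ys, P.NewtonEstimate Ys T C Y := by
  have hT : ∀ T, ∃ C, T ∈ P.TSet τ Ys → ∀ᶠ Y in 𝓝 Ys, P.NewtonEstimate Ys T C Y := fun T => by
    by_cases hT : T ∈ P.TSet τ Ys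
    · obtain ⟨C, hC⟩ := exists_newtonEstimate h hτ hlicq hT (hsoc T hT)
      exact ⟨C, fun _ => hC⟩
    · exact ⟨0, fun h0 => absurd h0 hT⟩
  choose C hC using hT
  refine ⟨1 + ∑ T, |C T|, le_add_of_nonneg_right (Finset.sum_nonneg fun _ _ => abs_nonneg _),
    eventually_all.2 fun T => ?_⟩
  by_cases hT : T ∈ P.TSet τ Ys
  · filter_upwards [hC T hT] with Y hY _
    refine hY.mono ((le_abs_self _).trans ?_)
    have := Finset.single_le_sum (f := fun T => |C T|) (fun _ _ => abs_nonneg _)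
      (Finset.mem_univ T)
    linarith
  · exact .of_forall fun _ h0 => absurd h0 hT

end Problem

/-! ### The Newton step -/

theorem exists_largest_entries {n : ℕ} (w : Fin n → ℝ) {s : ℕ} (hs : s ≤ n) :
    ∃ T : Finset (Fin n), T.card = s ∧ ∀ i ∈ T, ∀ j ∉ T, w j ≤ w i := by
  induction s with
  | zero => exact ⟨∅, rfl, by simp⟩
  | succ s ih =>
    obtain ⟨T, hT, hmax⟩ := ih (by omega)
    have hne : Tᶜ.Nonempty := by
      rw [← Finset.card_pos, Finset.card_compl, Fintype.card_fin]
      omega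
    obtain ⟨a, ha, hamax⟩ := Tᶜ.exists_max_image w hne
    have haT : a ∉ T := by simpa using ha
    refine ⟨insert a T, by rw [Finset.card_insert_of_notMem haT, hT], fun i hi j hj => ?_⟩
    rw [Finset.mem_insert, not_or] at hj
    rcases Finset.mem_insert.1 hi with rfl | hi
    · exact hamax j (by simpa using hj.2)
    · exact hmax i hi j hj.2

theorem isUnit_det_of_norm_le {ι : Type*} [Fintype ι] [DecidableEq ι] {W : Matrix ι ι ℝ} {C : ℝ}
    (h : ∀ v, ‖v‖ ≤ C * ‖Matrix.toEuclideanCLM (n := ι) (𝕜 := ℝ) W v‖) : IsUnit W.det := by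
  rw [← Matrix.isUnit_iff_isUnit_det, ← Matrix.mulVec_injective_iff_isUnit]
  intro v w hvw
  have h1 := h (WithLp.toLp 2 (v - w))
  rw [Matrix.toEuclideanCLM_toLp, Matrix.mulVec_sub, hvw, sub_self, WithLp.toLp_zero, norm_zero,
    mul_zero, norm_le_zero_iff] at h1
  exact sub_eq_zero.1 (congrArg (fun y => y.ofLp) h1)

theorem exists_toEuclideanCLM_eq {ι : Type*} [Fintype ι] [DecidableEq ι] {W : Matrix ι ι ℝ}
    (h : IsUnit W.det) (y : EuclideanSpace ℝ ι) :
    ∃ v, Matrix.toEuclideanCLM (n := ι) (𝕜 := ℝ) W v = y := by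
  refine ⟨WithLp.toLp 2 (W⁻¹.mulVec y.ofLp), ?_⟩
  rw [Matrix.toEuclideanCLM_toLp, Matrix.mulVec_mulVec, Matrix.mul_nonsing_inv _ h,
    Matrix.one_mulVec]

@[simp] theorem damped_one {n k m : ℕ} (T : Finset (Fin n)) (d : YSpace n k m) :
    damped T 1 d = d := by
  ext r
  simp [damped]

namespace Problem

variable {n k m : ℕ} {P : Problem n k m} {T : Finset (Fin n)} {Ys Y : YSpace n k m}
  {W : Matrix (Idx n k m) (Idx n k m) ℝ}

theorem TSet_nonempty (P : Problem n k m) (τ : ℝ) (Y : YSpace n k m) : (P.TSet τ Y).Nonempty :=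
  exists_largest_entries (fun i => |P.uVec τ Y i|) P.s_le

/-- The rows indexed by `K` of a matrix of the model form do not involve `ν_{T̄}`. -/
theorem apply_nu_eq_zero {p : Coef n k m}
    (hW : ∀ v, Matrix.toEuclideanCLM (n := Idx n k m) (𝕜 := ℝ) W v = P.modelJac T Y p v)
    {r : Idx n k m} (hr : r ∈ KSet k m T) {j : Fin n} (hj : j ∉ T) :
    W r (Sum.inr (Sum.inl j)) = 0 := by
  have h1 : W r (Sum.inr (Sum.inl j)) = P.modelJac T Y p
      (EuclideanSpace.single (Sum.inr (Sum.inl j)) 1) r := by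
    rw [← hW, Matrix.ofLp_toEuclideanCLM]
    simp
  have hx : xPart (EuclideanSpace.single (Sum.inr (Sum.inl j)) 1 : YSpace n k m) = 0 := by
    ext; simp
  rw [h1]
  rcases r with i | i | i | l
  · have hi : i ∈ T := by simpa [KSet] using hr
    have hij : i ≠ j := fun h0 => hj (h0 ▸ hi)
    simp [modelJac, gradLDeriv, hx, hi, hij]
  · have hi : i ∈ T := by simpa [KSet] using hr
    have hij : i ≠ j := fun h0 => hj (h0 ▸ hi)
    simp [modelJac, hi, hij]
  · simp [modelJac, hx]
  · simp [modelJac, hx, lin]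

/-- For directions with the prescribed components outside of `K`, the reduced equation is the full
Newton equation. -/
theorem reduced_equation_iff {p : Coef n k m}
    (hW : ∀ v, Matrix.toEuclideanCLM (n := Idx n k m) (𝕜 := ℝ) W v = P.modelJac T Y p v)
    {d : YSpace n k m} (hx : ∀ i ∉ T, xPart d i = -xPart Y i)
    (hν : ∀ i ∉ T, nuPart d i = -nuPart Y i) :
    (matG T W).mulVec (fun r : {r // r ∈ KSet k m T} => d r) = newtonRhs P T Y W ↔
      Matrix.toEuclideanCLM (n := Idx n k m) (𝕜 := ℝ) W d = -P.F T Y := by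
  have hK : ∀ r : {r // r ∈ KSet k m T},
      Matrix.toEuclideanCLM (n := Idx n k m) (𝕜 := ℝ) W d r =
        (matG T W).mulVec (fun r : {r // r ∈ KSet k m T} => d r) r -
          (matD T W).mulVec (fun j : {j // j ∉ T} => xPart Y j) r := by
    intro r
    have hG : (matG T W).mulVec (fun r : {r // r ∈ KSet k m T} => d r) r =
        ∑ c ∈ KSet k m T, W r c * d c :=
      Finset.sum_coe_sort (KSet k m T) fun c => W r c * d c
    have hD : (matD T W).mulVec (fun j : {j // j ∉ T} => xPart Y j) r =
        -∑ j : {j // j ∉ T}, W r (Sum.inl j) * d (Sum.inl (j : Fin n)) := by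
      rw [← Finset.sum_neg_distrib, Matrix.mulVec, dotProduct]
      refine Finset.sum_congr rfl fun j _ => ?_
      have := hx j j.2
      simp only [xPart_apply] at this
      simp only [matD, Matrix.submatrix_apply, this, xPart_apply]
      ring
    have hν0 : ∑ i ∈ T, W r (Sum.inr (Sum.inl i)) * d (Sum.inr (Sum.inl i)) =
        ∑ i, W r (Sum.inr (Sum.inl i)) * d (Sum.inr (Sum.inl i)) :=
      Finset.sum_subset (Finset.subset_univ T) fun i _ hi => by
        rw [apply_nu_eq_zero hW r.2 hi, zero_mul]
    have hx0 : ∑ i ∈ T, W r (Sum.inl i) * d (Sum.inl i) +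
        ∑ j : {j // j ∉ T}, W r (Sum.inl j) * d (Sum.inl (j : Fin n)) =
        ∑ i, W r (Sum.inl i) * d (Sum.inl i) := by
      rw [← Finset.sum_coe_sort T]
      convert Fintype.sum_subtype_add_sum_subtype (· ∈ T) fun i => W r (Sum.inl i) * d (Sum.inl i)
    rw [hG, hD, Matrix.ofLp_toEuclideanCLM]
    simp only [KSet, Finset.sum_disjSum, Matrix.mulVec, dotProduct, Fintype.sum_sum_type]
    rw [hν0, ← hx0]
    ring
  have hN : ∀ r, r ∉ KSet k m T →
      Matrix.toEuclideanCLM (n := Idx n k m) (𝕜 := ℝ) W d r = (-P.F T Y) r := by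
    intro r hr
    rw [hW]
    rcases r with i | i | i | l
    · have hi : i ∉ T := by simpa [KSet] using hr
      simpa [modelJac, F, hi] using hx i hi
    · have hi : i ∉ T := by simpa [KSet] using hr
      simpa [modelJac, F, hi] using hν i hi
    · simp [KSet] at hr
    · simp [KSet] at hr
  constructor
  · intro h
    ext r
    by_cases hr : r ∈ KSet k m T
    · rw [hK ⟨r, hr⟩, h]
      simp [newtonRhs]
    · exact hN r hr
  · intro h
    funext r
    have h1 := hK r
    rw [h] at h1
    simp only [PiLp.neg_apply] at h1
    simp only [newtonRhs, Pi.sub_apply]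
    linarith

namespace NewtonEstimate

variable {C : ℝ}

/-- The full Newton direction is admissible for the algorithm. -/
theorem exists_newton_direction (hE : P.NewtonEstimate Ys T C Y) (hW : W ∈ P.genJac T Y) :
    ∃ d : YSpace n k m, (∀ i ∉ T, xPart d i = -xPart Y i) ∧
      (∀ i ∉ T, nuPart d i = -nuPart Y i) ∧
      Matrix.toEuclideanCLM (n := Idx n k m) (𝕜 := ℝ) W d = -P.F T Y := by
  obtain ⟨p, hp⟩ := hE.model W hW
  obtain ⟨d, hd⟩ := exists_toEuclideanCLM_eq (isUnit_det_of_norm_le (hE.norm_le W hW)) (-P.F T Y)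
  refine ⟨d, fun i hi => ?_, fun i hi => ?_, hd⟩ <;> rw [hp] at hd
  · simpa [modelJac, F, hi] using congrArg (fun y => y.ofLp (Sum.inl i)) hd
  · simpa [modelJac, F, hi] using congrArg (fun y => y.ofLp (Sum.inr (Sum.inl i))) hd

/-- The reduced equation is solvable, so a direction computed by the algorithm is the full Newton
direction. -/
theorem newton_equation (hE : P.NewtonEstimate Ys T C Y) (hW : W ∈ P.genJac T Y)
    {ρ σ κ : ℝ} {d Y' : YSpace n k m} {t : ℕ} (hs : IsStep P ρ σ κ Y T W d t Y') :
    Matrix.toEuclideanCLM (n := Idx n k m) (𝕜 := ℝ) W d = -P.F T Y := by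
  obtain ⟨p, hp⟩ := hE.model W hW
  obtain ⟨d₀, hx, hν, hd₀⟩ := hE.exists_newton_direction hW
  exact (reduced_equation_iff hp hs.dir_x hs.dir_nu).1
    (hs.dir_solvable ⟨_, (reduced_equation_iff hp hx hν).2 hd₀⟩)

theorem norm_newton_sub_le (hE : P.NewtonEstimate Ys T C Y) (hC : 0 ≤ C) (hW : W ∈ P.genJac T Y)
    {d : YSpace n k m}
    (hd : Matrix.toEuclideanCLM (n := Idx n k m) (𝕜 := ℝ) W d = -P.F T Y) :
    ‖Y + d - Ys‖ ≤ C ^ 2 * ‖Y - Ys‖ ^ 2 := by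
  have h1 : Matrix.toEuclideanCLM (n := Idx n k m) (𝕜 := ℝ) W (Y + d - Ys) =
      -(P.F T Y - Matrix.toEuclideanCLM (n := Idx n k m) (𝕜 := ℝ) W (Y - Ys)) := by
    rw [show Y + d - Ys = (Y - Ys) + d by abel, map_add, hd]
    abel
  have h2 := hE.norm_le W hW (Y + d - Ys)
  rw [h1, norm_neg] at h2
  calc _ ≤ C * (C * ‖Y - Ys‖ ^ 2) := h2.trans (mul_le_mul_of_nonneg_left (hE.error_le W hW) hC)
    _ = _ := by ring

/-- The residual bounds the distance to the solution. -/
theorem norm_sub_le_norm_F (hE : P.NewtonEstimate Ys T C Y) (hC : 0 ≤ C) (hW : W ∈ P.genJac T Y)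
    (hsmall : C ^ 2 * ‖Y - Ys‖ ≤ 1 / 2) : ‖Y - Ys‖ ≤ 2 * C * ‖P.F T Y‖ := by
  have h1 := hE.norm_le W hW (Y - Ys)
  have h2 : ‖Matrix.toEuclideanCLM (n := Idx n k m) (𝕜 := ℝ) W (Y - Ys)‖ ≤
      ‖P.F T Y‖ + C * ‖Y - Ys‖ ^ 2 := by
    have h3 := norm_sub_norm_le (Matrix.toEuclideanCLM (n := Idx n k m) (𝕜 := ℝ) W (Y - Ys))
      (P.F T Y)
    rw [norm_sub_rev] at h3
    linarith [hE.error_le W hW]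
  have h4 := mul_le_mul_of_nonneg_left h2 hC
  have h5 := mul_le_mul_of_nonneg_right hsmall (norm_nonneg (Y - Ys))
  nlinarith

/-- Close to the solution the full Newton step satisfies the Armijo condition with `σ < 1 / 2`. -/
theorem armijo_zero (hE : P.NewtonEstimate Ys T C Y) (hC : 0 ≤ C) (hW : W ∈ P.genJac T Y)
    {d : YSpace n k m} (hE' : P.NewtonEstimate Ys T C (Y + d))
    (hd : Matrix.toEuclideanCLM (n := Idx n k m) (𝕜 := ℝ) W d = -P.F T Y)
    (hsmall : C ^ 2 * ‖Y - Ys‖ ≤ 1 / 2) {σ : ℝ} (hσ0 : 0 < σ) (hσ : σ < 1 / 2)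
    (hsmall' : 2 * C ^ 4 * ‖Y - Ys‖ ≤ 1 - 2 * σ) (ρ : ℝ) : Armijo P ρ σ Y T W d 0 := by
  have h1 : ‖P.F T (Y + d)‖ ≤ (1 - 2 * σ) * ‖P.F T Y‖ := by
    calc ‖P.F T (Y + d)‖ ≤ C * (C ^ 2 * ‖Y - Ys‖ ^ 2) :=
          hE'.norm_F_le.trans (mul_le_mul_of_nonneg_left (hE.norm_newton_sub_le hC hW hd) hC)
      _ = C ^ 3 * ‖Y - Ys‖ * ‖Y - Ys‖ := by ring
      _ ≤ C ^ 3 * ‖Y - Ys‖ * (2 * C * ‖P.F T Y‖) :=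
          mul_le_mul_of_nonneg_left (hE.norm_sub_le_norm_F hC hW hsmall) (by positivity)
      _ = 2 * C ^ 4 * ‖Y - Ys‖ * ‖P.F T Y‖ := by ring
      _ ≤ _ := mul_le_mul_of_nonneg_right hsmall' (norm_nonneg _)
  have h2 := pow_le_pow_left₀ (norm_nonneg _) h1 2
  have h3 : (1 - 2 * σ) ^ 2 * ‖P.F T Y‖ ^ 2 ≤ (1 - 2 * σ) * ‖P.F T Y‖ ^ 2 :=
    mul_le_mul_of_nonneg_right (by nlinarith) (sq_nonneg _)
  rw [Armijo, pow_zero, damped_one, hd, inner_neg_right, real_inner_self_eq_norm_sq, merit, merit]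
  rw [mul_pow] at h2
  linarith

end NewtonEstimate

end Problem

end SNSQP

/-! ### Local quadratic convergence -/

theorem mainTheorem1 {n k m : ℕ} (P : SNSQP.Problem n k m) (τ : ℝ) (hτ : 0 < τ)
    (Ys : SNSQP.YSpace n k m) (hstat : P.IsPStationary τ Ys)
    (hlicq : P.RestrictedLICQ (SNSQP.xPart Ys))
    (hsoc : ∀ T ∈ P.TSet τ Ys, P.StrongSOC Ys T)
    (σ : ℝ) (hσ0 : 0 < σ) (hσ : σ < 1 / 2) :
    ∃ U ∈ 𝓝 Ys, ∃ C : ℝ, 0 < C ∧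
      ∀ ρ : ℝ, 0 < ρ → ρ < 1 →
        -- every iteration started in the neighbourhood can be carried out, for each choice of `W`
        (∀ Y ∈ U, ∀ T ∈ P.TSet τ Y, (P.genJac T Y).Nonempty ∧
          ∀ W ∈ P.genJac T Y, ∀ κ : ℝ, 0 < κ →
            ∃ d t Y', SNSQP.IsStep P ρ σ κ Y T W d t Y' ∧ (P.TSet τ Y').Nonempty) ∧
        -- every run started in the neighbourhood, with arbitrary choices of `T_ℓ` and `W^ℓ`
        ∀ (ε : ℝ) (κ : ℕ → ℝ), 0 ≤ ε → (∀ l, 0 < κ l) → Antitone κ → Tendsto κ atTop (𝓝 0) →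
          ∀ (N : ℕ∞) (Y : ℕ → SNSQP.YSpace n k m) (T : ℕ → Finset (Fin n))
            (W : ℕ → Matrix (SNSQP.Idx n k m) (SNSQP.Idx n k m) ℝ)
            (d : ℕ → SNSQP.YSpace n k m) (t : ℕ → ℕ),
            SNSQP.IsRun P τ ρ σ ε κ N Y T W d t → Y 0 ∈ U →
              -- full Newton steps and the quadratic rate
              (∀ l : ℕ, (l : ℕ∞) < N →
                IsUnit (W l).det ∧
                Matrix.toEuclideanCLM (n := SNSQP.Idx n k m) (𝕜 := ℝ) (W l) (d l) =
                  -P.F (T l) (Y l) ∧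
                t l = 0 ∧
                Y (l + 1) = Y l + d l ∧
                Y (l + 1) ∈ U ∧
                ‖Y (l + 1) - Ys‖ ≤ C * ‖Y l - Ys‖ ^ 2) ∧
              -- convergence, also if the equations are solved exactly after finitely many steps
              (N = ⊤ → Tendsto Y atTop (𝓝 Ys)) ∧
              (∀ l : ℕ, (l : ℕ∞) ≤ N → P.F (T l) (Y l) = 0 → Y l = Ys) := by
  obtain ⟨C, hC1, hC⟩ := SNSQP.Problem.exists_uniform_newtonEstimate hstat hτ hlicq hsoc
  obtain ⟨r₀, hr₀, hball⟩ :=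
    Metric.eventually_nhds_iff_ball.1 (hC.and hstat.eventually_TSet_subset)
  have hC0 : 0 < C := by linarith
  -- the second bound makes the Newton step a contraction, the third gives the Armijo condition
  set r := min r₀ (min (1 / (2 * C ^ 2)) ((1 - 2 * σ) / (2 * C ^ 4)))
  have hrpos : 0 < r := lt_min hr₀ (lt_min (by positivity) (div_pos (by linarith) (by positivity)))
  have hE : ∀ Y ∈ Metric.ball Ys r, ∀ T ∈ P.TSet τ Ys, P.NewtonEstimate Ys T C Y :=
    fun Y hY => (hball Y (Metric.ball_subset_ball (min_le_left _ _) hY)).1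
  have hTS : ∀ Y ∈ Metric.ball Ys r, P.TSet τ Y ⊆ P.TSet τ Ys :=
    fun Y hY => (hball Y (Metric.ball_subset_ball (min_le_left _ _) hY)).2
  have hsmall : ∀ Y ∈ Metric.ball Ys r, C ^ 2 * ‖Y - Ys‖ ≤ 1 / 2 := by
    intro Y hY
    rw [mem_ball_iff_norm] at hY
    have := hY.le.trans ((min_le_right _ _).trans (min_le_left _ _))
    rw [le_div_iff₀ (by positivity)] at this
    linarith
  have hsmall' : ∀ Y ∈ Metric.ball Ys r, 2 * C ^ 4 * ‖Y - Ys‖ ≤ 1 - 2 * σ := by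
    intro Y hY
    rw [mem_ball_iff_norm] at hY
    have := hY.le.trans ((min_le_right _ _).trans (min_le_right _ _))
    rw [le_div_iff₀ (by positivity)] at this
    linarith
  -- the Newton step at least halves the distance to `Ys`
  have hhalf : ∀ Y ∈ Metric.ball Ys r, ∀ T ∈ P.TSet τ Y, ∀ W ∈ P.genJac T Y, ∀ d,
      Matrix.toEuclideanCLM (n := SNSQP.Idx n k m) (𝕜 := ℝ) W d = -P.F T Y →
      ‖Y + d - Ys‖ ≤ C ^ 2 * ‖Y - Ys‖ ^ 2 ∧ ‖Y + d - Ys‖ ≤ 1 / 2 * ‖Y - Ys‖ ∧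
        Y + d ∈ Metric.ball Ys r := by
    intro Y hY T hT W hW d hd
    have h1 := (hE Y hY T (hTS Y hY hT)).norm_newton_sub_le hC0.le hW hd
    have h2 : ‖Y + d - Ys‖ ≤ 1 / 2 * ‖Y - Ys‖ := by
      have := mul_le_mul_of_nonneg_right (hsmall Y hY) (norm_nonneg (Y - Ys))
      linarith
    refine ⟨h1, h2, ?_⟩
    rw [mem_ball_iff_norm] at hY ⊢
    linarith [norm_nonneg (Y - Ys)]
  have harmijo : ∀ Y ∈ Metric.ball Ys r, ∀ T ∈ P.TSet τ Y, ∀ W ∈ P.genJac T Y, ∀ d,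
      Matrix.toEuclideanCLM (n := SNSQP.Idx n k m) (𝕜 := ℝ) W d = -P.F T Y → ∀ ρ,
      SNSQP.Armijo P ρ σ Y T W d 0 := by
    intro Y hY T hT W hW d hd ρ
    have hT' := hTS Y hY hT
    exact (hE Y hY T hT').armijo_zero hC0.le hW (hE _ (hhalf Y hY T hT W hW d hd).2.2 T hT') hd
      (hsmall Y hY) hσ0 hσ (hsmall' Y hY) ρ
  refine ⟨Metric.ball Ys r, Metric.ball_mem_nhds _ hrpos, C ^ 2, by positivity,
    fun ρ _ _ => ⟨fun Y hY T hT => ⟨P.genJac_nonempty T Y, fun W hW κ _ => ?_⟩, ?_⟩⟩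
  · have hE₁ := hE Y hY T (hTS Y hY hT)
    obtain ⟨p, hp⟩ := hE₁.model W hW
    obtain ⟨d, hx, hν, hd⟩ := hE₁.exists_newton_direction hW
    have hred := (SNSQP.Problem.reduced_equation_iff hp hx hν).2 hd
    exact ⟨d, 0, Y + SNSQP.damped T (ρ ^ 0) d,
      ⟨hW, hx, hν, fun _ => hred, fun hn => absurd ⟨_, hred⟩ hn,
        ⟨harmijo Y hY T hT W hW d hd ρ, fun t _ => Nat.zero_le t⟩, rfl⟩, P.TSet_nonempty τ _⟩
  · intro ε κ _ _ _ _ N Y T W d t hrun hY0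
    have hTl : ∀ l : ℕ, (l : ℕ∞) ≤ N → T l ∈ P.TSet τ (Y l) := by
      intro l hl
      cases l with
      | zero => exact hrun.init
      | succ l =>
        exact hrun.index l (lt_of_lt_of_le (by exact_mod_cast Nat.lt_succ_self l) hl)
    have hstep : ∀ l : ℕ, (l : ℕ∞) < N → Y l ∈ Metric.ball Ys r →
        Matrix.toEuclideanCLM (n := SNSQP.Idx n k m) (𝕜 := ℝ) (W l) (d l) = -P.F (T l) (Y l) ∧
        t l = 0 ∧ Y (l + 1) = Y l + d l := by
      intro l hl hYl
      have hs := hrun.step l hl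
      have hT := hTl l hl.le
      have hd := (hE _ hYl _ (hTS _ hYl hT)).newton_equation hs.jac hs
      have ht : t l = 0 :=
        Nat.le_zero.1 (hs.line_search.2 (harmijo _ hYl _ hT _ hs.jac _ hd ρ))
      refine ⟨hd, ht, ?_⟩
      rw [hs.update, ht, pow_zero, SNSQP.damped_one]
    have hU : ∀ l : ℕ, (l : ℕ∞) ≤ N → Y l ∈ Metric.ball Ys r := by
      intro l
      induction l with
      | zero => exact fun _ => hY0
      | succ l ih =>
        intro hl
        have hl' : (l : ℕ∞) < N := lt_of_lt_of_le (by exact_mod_cast Nat.lt_succ_self l) hl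
        obtain ⟨hd, -, hY⟩ := hstep l hl' (ih hl'.le)
        rw [hY]
        exact (hhalf _ (ih hl'.le) _ (hTl l hl'.le) _ (hrun.step l hl').jac _ hd).2.2
    refine ⟨fun l hl => ?_, fun hN => ?_, fun l hl hF => ?_⟩
    · have hYl := hU l hl.le
      have hT := hTl l hl.le
      have hW := (hrun.step l hl).jac
      obtain ⟨hd, ht, hY⟩ := hstep l hl hYl
      obtain ⟨h1, -, h2⟩ := hhalf _ hYl _ hT _ hW _ hd
      rw [← hY] at h1 h2
      exact ⟨SNSQP.isUnit_det_of_norm_le ((hE _ hYl _ (hTS _ hYl hT)).norm_le _ hW), hd, ht, hY,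
        h2, h1⟩
    · have hlt : ∀ l : ℕ, (l : ℕ∞) < N := fun l => hN ▸ ENat.natCast_lt_top l
      have hgeom : ∀ l, ‖Y l - Ys‖ ≤ (1 / 2) ^ l * ‖Y 0 - Ys‖ := by
        intro l
        induction l with
        | zero => simp
        | succ l ih =>
          have hYl := hU l (hlt l).le
          obtain ⟨hd, -, hY⟩ := hstep l (hlt l) hYl
          have h1 := (hhalf _ hYl _ (hTl l (hlt l).le) _ (hrun.step l (hlt l)).jac _ hd).2.1
          rw [← hY] at h1
          rw [pow_succ]
          linarith
      refine tendsto_iff_norm_sub_tendsto_zero.2 (squeeze_zero (fun _ => norm_nonneg _) hgeom ?_)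
      simpa using (tendsto_pow_atTop_nhds_zero_of_lt_one (by norm_num : (0 : ℝ) ≤ 1 / 2)
        (by norm_num)).mul_const ‖Y 0 - Ys‖
    · have hYl := hU l hl
      obtain ⟨V, hV⟩ := P.genJac_nonempty (T l) (Y l)
      have h1 := (hE _ hYl _ (hTS _ hYl (hTl l hl))).norm_sub_le_norm_F hC0.le hV (hsmall _ hYl)
      rw [hF, norm_zero, mul_zero] at h1
      exact sub_eq_zero.1 (norm_le_zero_iff.1 h1)
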